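/- **Setting.** Let $K\ge 2$ (arms), $T\ge 2$ (rounds), $\alpha\in(1,2]$, $\sigma\ge 0$. For every round $t\in\{1,\dots,T\}$ and arm $i\in\{1,\dots,K\}$ let $\nu_{t,i}$ be a probability distribution on $\mathbb R$ with $\mathbb E_{\ell\sim\nu_{t,i}}|\ell|^\alpha\le\sigma^\alpha$. In round $t$ the player chooses an arm $i_t$; a loss vector $\boldsymbol\ell_t=(\ell_{t,1},\dots,\ell_{t,K})$ with marginals $\ell_{t,i}\sim\nu_{t,i}$ is drawn independently of the player's earlier observations and of $i_t$; the player observes only $\ell_{t,i_t}$. The pseudo-regret is $\mathcal R_T=\max_{i}\mathbb E\big[\sum_{t=1}^T\ell_{t,i_t}-\sum_{t=1}^T\ell_{t,i}\big]$. Assume that some arm $i^\ast$ minimizing $\mathbb E\sum_{t}\ell_{t,i}$ is truncated non-negative, i.e. $\mathbb E[\ell_{t,i^\ast}\mathbf 1\{|\ell_{t,i^\ast}|>M\}]\ge 0$ for all $M\ge 0$ and all $t\le T$. **Algorithm uniINF** (its only inputs are $K$ and $T$). Put $S_1=4$ and $\boldsymbol L_0=\boldsymbol 0$. In round $t=1,\dots,T$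 let $\boldsymbol x_t$ be the minimizer of $\langle \boldsymbol L_{t-1},\boldsymbol x\rangle-S_t\sum_{i}\log x_i$ over the probability simplex and sample $i_t\sim\boldsymbol x_t$ given the earlier observations. Put $C_t=\frac{S_t}{4(1-x_{t,i_t})}$. Let $\ell^{\rm skip}_t$ equal $\ell_{t,i_t}$ if $|\ell_{t,i_t}|<C_t$ and $0$ otherwise, and let $\ell^{\rm clip}_t$ be $\ell_{t,i_t}$ clipped to $[-C_t,C_t]$. Add $\ell^{\rm skip}_t/x_{t,i_t}$ to the $i_t$-th coordinate of $\boldsymbol L_{t-1}$ to get $\boldsymbol L_t$, and put $S_{t+1}^2=S_t^2+(\ell^{\rm clip}_t)^2(1-x_{t,i_t})^2/(K\log T)$. **Theorem.** Write $\log^+ y=\max(0,\log y)$ for $y>0$ and $\log^+0=0$. There are an absolute constant $C>0$ and a function $T_0(K,\alpha,\sigma)$ such that, in every setting as above, uniINF satisfies the following. 1. (Adversarial environments, i.e. arbitrary $\nu_{t,i}$.) $$\mathcal R_T\le C\left[\sigma K^{1-1/\alpha}T^{1/\alpha}(\log T)^{1-1/\alpha}\left(1+\log^+\!\Big(\sigma\Big(\frac{T}{K\log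 T}\Big)^{1/\alpha}\Big)\right)+K\log T\right],$$ and for all $T\ge T_0(K,\alpha,\sigma)$ $$\mathcal R_T\le C\,\sigma K^{1-1/\alpha}T^{1/\alpha}(\log T)^{2-1/\alpha}=\widetilde{O}\big(\sigma K^{1-1/\alpha}T^{1/\alpha}\big).$$ 2. (Stochastic environments, i.e. $\nu_{t,i}=\nu_{1,i}$ for all $t\le T$, with a unique best arm $i^\ast$.) Let $\Delta_i=\mathbb E_{\nu_{1,i}}[\ell]-\mathbb E_{\nu_{1,i^\ast}}[\ell]>0$ for $i\ne i^\ast$, $\Delta_{\min}=\min_{i\neq i^\ast}\Delta_i$ and $\rho=\sigma^\alpha/\Delta_{\min}$. Then $$\mathcal R_T\le C^{\frac1{\alpha-1}}\,K\log T\,\Big(1+\rho^{\frac1{\alpha-1}}\,(1+\log^+\rho)\Big),$$ and consequently, if $\rho\ge 2$, $$\mathcal R_T\le C^{\frac1{\alpha-1}}\,K\,\Big(\frac{\sigma^\alpha}{\Delta_{\min}}\Big)^{\frac1{\alpha-1}}\log T\cdot\log\frac{\sigma^\alpha}{\Delta_{\min}}.$$ -/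

import Mathlib

open MeasureTheory ProbabilityTheory

namespace UniINF

/-! ### The algorithm

Rounds are indexed by `t = 0, …, T - 1`. -/

/-- The probability vectors on `K` arms all of whose entries are positive. The log-barrier is `+∞` on
the rest of the simplex, so a minimizer over the simplex is a minimizer over this set. -/
def posSimplex (K : ℕ) : Set (Fin K → ℝ) := {x | x ∈ stdSimplex ℝ (Fin K) ∧ ∀ i, 0 < x i}

/-- The objective `⟨L, x⟩ + Ψ(x)` with the log-barrier `Ψ(x) = -S ∑ i, log x i`. -/
noncomputable def objective {K : ℕ} (S : ℝ) (L x : Fin K → ℝ) : ℝ :=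
  ∑ i, L i * x i + -S * ∑ i, Real.log (x i)

/-- `x` is a minimizer of the objective over the simplex. -/
def IsFTRL {K : ℕ} (S : ℝ) (L x : Fin K → ℝ) : Prop :=
  x ∈ posSimplex K ∧ ∀ y ∈ posSimplex K, objective S L x ≤ objective S L y

/-- For `S > 0` the minimizer exists and is unique. -/
theorem existsUnique_isFTRL {K : ℕ} (hK : 0 < K) {S : ℝ} (hS : 0 < S) (L : Fin K → ℝ) :
    ∃! x, IsFTRL S L x := by
  have hK' : (0 : ℝ) < K := by exact_mod_cast hK
  have hle1 : ∀ x ∈ posSimplex K, ∀ i, x i ≤ 1 := fun x hx i =>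
    hx.1.2 ▸ Finset.single_le_sum (fun j _ => hx.1.1 j) (Finset.mem_univ i)
  set u : Fin K → ℝ := fun _ => (K : ℝ)⁻¹ with hu
  have hu_mem : u ∈ posSimplex K :=
    ⟨⟨fun i => by positivity, by simp [hu, hK'.ne']⟩, fun i => by positivity⟩
  set B : ℝ := ∑ i, |L i| with hB
  have hlin : ∀ x ∈ posSimplex K, -B ≤ ∑ i, L i * x i := by
    intro x hx
    rw [hB, ← Finset.sum_neg_distrib]
    refine Finset.sum_le_sum fun i _ => ?_
    have h1 := hle1 x hx i
    have h0 := (hx.2 i).le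
    have h2 : |L i * x i| ≤ |L i| := by
      rw [abs_mul, abs_of_nonneg h0]
      exact mul_le_of_le_one_right (abs_nonneg _) h1
    linarith [neg_abs_le (L i * x i)]
  set ε : ℝ := Real.exp (-((objective S L u + B) / S)) with hε
  have hεpos : 0 < ε := Real.exp_pos _
  have hlow : ∀ x ∈ posSimplex K, objective S L x ≤ objective S L u → ∀ i, ε ≤ x i := by
    intro x hx hxu i
    have h1 : ∑ j, Real.log (x j) ≤ Real.log (x i) := by
      rw [← Finset.add_sum_erase _ _ (Finset.mem_univ i)]
      have : ∑ j ∈ Finset.univ.erase i, Real.log (x j) ≤ 0 :=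
        Finset.sum_nonpos fun j _ => Real.log_nonpos (hx.2 j).le (hle1 x hx j)
      linarith
    have h2 := hlin x hx
    have h3 : -S * Real.log (x i) ≤ objective S L u + B := by
      have : -S * Real.log (x i) ≤ -S * ∑ j, Real.log (x j) := by nlinarith
      have h4 : objective S L x = ∑ i, L i * x i + -S * ∑ i, Real.log (x i) := rfl
      linarith
    have h5 : -((objective S L u + B) / S) ≤ Real.log (x i) := by
      rw [neg_le, le_div_iff₀ hS]
      linarith
    calc ε ≤ Real.exp (Real.log (x i)) := Real.exp_le_exp.2 h5
      _ = x i := Real.exp_log (hx.2 i)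
  set A : Set (Fin K → ℝ) := stdSimplex ℝ (Fin K) ∩ {x | ∀ i, ε ≤ x i} with hA
  have hAc : IsCompact A := by
    refine (isCompact_stdSimplex ℝ (Fin K)).inter_right ?_
    simp only [Set.ofPred_forall]
    exact isClosed_iInter fun i => isClosed_le continuous_const (continuous_apply i)
  have hApos : A ⊆ posSimplex K := fun x hx => ⟨hx.1, fun i => hεpos.trans_le (hx.2 i)⟩
  have hcont : ContinuousOn (objective S L) A := by
    unfold objective
    refine ContinuousOn.add (by fun_prop) (ContinuousOn.mul continuousOn_const ?_)
    refine continuousOn_finsetSum _ fun i _ => ?_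
    exact ContinuousOn.log (by fun_prop) fun x hx => ((hApos hx).2 i).ne'
  obtain ⟨x, hxA, hxmin⟩ := hAc.exists_isMinOn ⟨u, hu_mem.1, hlow u hu_mem le_rfl⟩ hcont
  have hx : IsFTRL S L x := by
    refine ⟨hApos hxA, fun y hy => ?_⟩
    rcases le_total (objective S L y) (objective S L u) with h | h
    · exact hxmin ⟨hy.1, hlow y hy h⟩
    · exact (hxmin ⟨hu_mem.1, hlow u hu_mem le_rfl⟩ : objective S L x ≤ objective S L u).trans h
  refine ⟨x, hx, fun y hy => ?_⟩
  by_contra hne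
  obtain ⟨j, hj⟩ : ∃ j, y j ≠ x j := by
    by_contra h
    push Not at h
    exact hne (funext h)
  set m : Fin K → ℝ := fun i => (1 / 2 : ℝ) * y i + (1 / 2) * x i with hm
  have hmm : m ∈ posSimplex K := by
    refine ⟨⟨fun i => ?_, ?_⟩, fun i => ?_⟩
    · have := hy.1.2 i
      have := hx.1.2 i
      simp only [hm]; positivity
    · simp only [hm, Finset.sum_add_distrib, ← Finset.mul_sum]
      rw [hy.1.1.2, hx.1.1.2]; norm_num
    · have := hy.1.2 i
      have := hx.1.2 i
      simp only [hm]; positivity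
  have hlogle : ∀ i, (1 / 2 : ℝ) * Real.log (y i) + (1 / 2) * Real.log (x i) ≤ Real.log (m i) := by
    intro i
    exact strictConcaveOn_log_Ioi.concaveOn.2 (hy.1.2 i) (hx.1.2 i) (by norm_num) (by norm_num)
      (by norm_num)
  have hloglt : (1 / 2 : ℝ) * Real.log (y j) + (1 / 2) * Real.log (x j) < Real.log (m j) :=
    strictConcaveOn_log_Ioi.2 (hy.1.2 j) (hx.1.2 j) hj (by norm_num) (by norm_num) (by norm_num)
  have hsum : (1 / 2 : ℝ) * ∑ i, Real.log (y i) + (1 / 2) * ∑ i, Real.log (x i)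
      < ∑ i, Real.log (m i) := by
    rw [Finset.mul_sum, Finset.mul_sum, ← Finset.sum_add_distrib]
    exact Finset.sum_lt_sum (fun i _ => hlogle i) ⟨j, Finset.mem_univ j, hloglt⟩
  have hlinm : ∑ i, L i * m i = (1 / 2 : ℝ) * ∑ i, L i * y i + (1 / 2) * ∑ i, L i * x i := by
    rw [Finset.mul_sum, Finset.mul_sum, ← Finset.sum_add_distrib]
    exact Finset.sum_congr rfl fun i _ => by simp only [hm]; ring
  have h1 := hy.2 m hmm
  have h2 := hx.2 m hmm
  unfold objective at h1 h2
  rw [hlinm] at h1 h2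
  nlinarith [mul_lt_mul_of_pos_left hsum hS]

/-- The action `x` chosen by Follow-the-Regularized-Leader. -/
noncomputable def ftrl {K : ℕ} (S : ℝ) (L : Fin K → ℝ) : Fin K → ℝ :=
  Classical.epsilon (IsFTRL S L)

theorem ftrl_spec {K : ℕ} (hK : 0 < K) {S : ℝ} (hS : 0 < S) (L : Fin K → ℝ) :
    IsFTRL S L (ftrl S L) :=
  Classical.epsilon_spec (existsUnique_isFTRL hK hS L).exists

/-- The skipped loss. -/
noncomputable def skip (l C : ℝ) : ℝ := if |l| < C then l else 0

/-- The clipped loss. -/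
noncomputable def clip (l C : ℝ) : ℝ := if C ≤ l then C else if l ≤ -C then -C else l

/-- What the player keeps between rounds: the inverse learning rate `S` and the sum `L` of the
loss estimates so far. -/
structure State (K : ℕ) where
  S : ℝ
  L : Fin K → ℝ

/-- The probability vector from which the player samples in state `s`. -/
noncomputable def State.x {K : ℕ} (s : State K) : Fin K → ℝ := ftrl s.S s.L

/-- The threshold for arm `i` in state `s`. -/
noncomputable def State.C {K : ℕ} (s : State K) (i : Fin K) : ℝ := s.S / (4 * (1 - s.x i))

/-- The importance-weighted estimate of the skipped loss vector, after arm `i` was played and the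
loss `l` was observed. -/
noncomputable def State.estimate {K : ℕ} (s : State K) (i : Fin K) (l : ℝ) : Fin K → ℝ :=
  fun j => if j = i then skip l (s.C i) / s.x i else 0

/-- The update in a game of `T` rounds, after arm `i` was played and the loss `l` was observed. -/
noncomputable def State.next {K : ℕ} (T : ℕ) (s : State K) (i : Fin K) (l : ℝ) : State K where
  S := Real.sqrt (s.S ^ 2 + clip l (s.C i) ^ 2 * (1 - s.x i) ^ 2 * ((K : ℝ) * Real.log T)⁻¹)
  L := fun j => s.L j + s.estimate i l j

/-- The state before round `t`, as a function of the observed pairs (arm, loss of that arm) of the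
rounds before `t`. -/
noncomputable def state {K : ℕ} (T : ℕ) (obs : ℕ → Fin K × ℝ) : ℕ → State K
  | 0 => ⟨4, fun _ => 0⟩
  | t + 1 => (state T obs t).next T (obs t).1 (obs t).2

/-! ### Environments

`ν t i` is the loss distribution of arm `i` in round `t`. -/

/-- The heavy-tail condition `E |ℓ| ^ α ≤ σ ^ α`. -/
def HeavyTailed (α σ : ℝ) (ν : Measure ℝ) : Prop :=
  Integrable (fun l => |l| ^ α) ν ∧ ∫ l, |l| ^ α ∂ν ≤ σ ^ α

/-- Truncated non-negativity: `E [ℓ 1{|ℓ| > M}] ≥ 0` for all `M ≥ 0`. -/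
def TruncatedNonneg (ν : Measure ℝ) : Prop := ∀ M : ℝ, 0 ≤ M → 0 ≤ ∫ l in {l | M < |l|}, l ∂ν

/-- Arm `i` minimizes the expected total loss over `T` rounds. -/
def IsOptimalArm {K : ℕ} (T : ℕ) (ν : ℕ → Fin K → Measure ℝ) (i : Fin K) : Prop :=
  ∀ j, ∑ t ∈ Finset.range T, ∫ l, l ∂ν t i ≤ ∑ t ∈ Finset.range T, ∫ l, l ∂ν t j

/-- The gap of arm `i` with respect to arm `b`, in the first round. -/
noncomputable def gap {K : ℕ} (ν : ℕ → Fin K → Measure ℝ) (b i : Fin K) : ℝ :=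
  ∫ l, l ∂ν 0 i - ∫ l, l ∂ν 0 b

/-- The minimal gap of the arms other than `b`. -/
noncomputable def minGap {K : ℕ} (ν : ℕ → Fin K → Measure ℝ) (b : Fin K) : ℝ :=
  ⨅ i : {i : Fin K // i ≠ b}, gap ν b i

/-- The environment is stochastic: the loss distributions do not change with time. -/
def IsStochastic {K : ℕ} (T : ℕ) (ν : ℕ → Fin K → Measure ℝ) : Prop :=
  ∀ t < T, ∀ i, ν t i = ν 0 i

/-- Arm `b` is the unique best arm (of a stochastic environment). -/
def IsUniqueBestArm {K : ℕ} (ν : ℕ → Fin K → Measure ℝ) (b : Fin K) : Prop :=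
  ∀ i, i ≠ b → 0 < gap ν b i

/-! ### The interaction -/

section Interaction

variable {K : ℕ} {Ω : Type*}

/-- What the player observes in round `t`: the arm `arm t` it plays and the loss of that arm. -/
def obs (loss : ℕ → Ω → Fin K → ℝ) (arm : ℕ → Ω → Fin K) (ω : Ω) (t : ℕ) : Fin K × ℝ :=
  (arm t ω, loss t ω (arm t ω))

/-- The observations made before round `t`. -/
def history (loss : ℕ → Ω → Fin K → ℝ) (arm : ℕ → Ω → Fin K) (t : ℕ) (ω : Ω) :
    Fin t → Fin K × ℝ :=
  fun s => obs loss arm ω s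

/-- `loss`, `arm` are the loss vectors and the played arms when uniINF plays `T` rounds in the
(oblivious) environment with loss distributions `ν`. -/
structure IsRun [MeasurableSpace Ω] (T : ℕ) (ν : ℕ → Fin K → Measure ℝ) (P : Measure Ω)
    (loss : ℕ → Ω → Fin K → ℝ) (arm : ℕ → Ω → Fin K) : Prop where
  measurable_loss : ∀ t < T, Measurable (loss t)
  measurable_arm : ∀ t < T, Measurable (arm t)
  /-- The loss of arm `i` in round `t` has law `ν t i`. -/
  law_loss : ∀ t < T, ∀ i, P.map (fun ω => loss t ω i) = ν t i
  /-- The loss vector of round `t` is drawn independently of the earlier observations and of the arm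
  that the player chooses in round `t`. -/
  indep_loss : ∀ t < T, IndepFun (loss t) (fun ω => (history loss arm t ω, arm t ω)) P
  /-- Given the earlier observations, the arm of round `t` is sampled from the probability vector
  that the algorithm computes from them. -/
  sample_arm : ∀ t < T, ∀ i,
    P⟦arm t ⁻¹' {i} | MeasurableSpace.comap (history loss arm t) inferInstance⟧
      =ᵐ[P] fun ω => (state T (obs loss arm ω) t).x i

/-- The pseudo-regret after `T` rounds. -/
noncomputable def regret [MeasurableSpace Ω] (T : ℕ) (P : Measure Ω)
    (loss : ℕ → Ω → Fin K → ℝ) (arm : ℕ → Ω → Fin K) : ℝ :=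
  ⨆ i : Fin K, ∫ ω, (∑ t ∈ Finset.range T, loss t ω (arm t ω)
    - ∑ t ∈ Finset.range T, loss t ω i) ∂P

end Interaction

end UniINF

/-!
The regret against the optimal arm `b` splits into three parts: the regret of the FTRL iterates on
the skipped losses against a smoothed version of `b`, the `O(σ)` cost of the smoothing, and the
error caused by skipping (`round_regret_le`). Write `N = K log T`, and let `S` be the final
inverse learning rate.

*FTRL.* On the simplex all losses may be shifted by the same amount, so the stability cost of a
round is `O(ℓ² (1 - x)² / S)` (`IsFTRL.stability`), where the thresholds guarantee `|ℓ| (1 - x) ≤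
S / 4`. By the choice of the learning rate this is `O(N)` times the increment of `S`; the barrier
at the comparator costs another `O(N S)`. Hence the first part is `O(N S)` along every sequence of
observations (`sum_skipped_sub_comparator_le`).

*Skipping.* The losses of `b` are truncated non-negative, so skipping them does no harm. For the
other arms, losses above a cutoff `M` contribute at most `σ ^ α M ^ (1 - α)` by the moment bound.
A skipped loss of size at most `M` contributes at most `M`, and there are only `O(N log⁺ M)` of
them, since each one multiplies `S` by a constant factor and can occur only while `S ≤ 4 M`
(`card_skip_le`).

*Learning rate.* Clipping gives `S ^ α ≤ 4 ^ α + ∑ |ℓ| ^ α (1 - x) / N` (`S_rpow_le`). In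
expectation the sum is at most `2 σ ^ α U / N`, where the exploration `U` is the expected number
of rounds in which an arm other than `b` is played. For an arbitrary level `A`, the inequality
`S ≤ A + S ^ α A ^ (1 - α)` replaces Jensen's inequality.

Together these bound the regret in terms of `U` and the free levels `A` and `M`
(`IsRun.sum_roundRegret_le_levels`). In the adversarial case `U ≤ T`. In the stochastic case the
regret is at least `Δ_min U`, so the terms with `U` are absorbed for suitable levels. If there are
more arms than rounds, the trivial bound `2 σ T` suffices.

Expectations are computed round by round in `IsRun.integral_round`. This needs the state of the
algorithm to be a measurable function of the past, which holds because the FTRL minimizer is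
explicit up to a Lagrange multiplier (`measurable_ftrl`).
-/

namespace UniINF

/-! ### Stability of FTRL with the log-barrier -/

theorem posSimplex.le_one {K : ℕ} {x : Fin K → ℝ} (hx : x ∈ posSimplex K) (i : Fin K) : x i ≤ 1 :=
  hx.1.2 ▸ Finset.single_le_sum (fun j _ => hx.1.1 j) (Finset.mem_univ i)

theorem posSimplex.sum_erase {K : ℕ} {x : Fin K → ℝ} (hx : x ∈ posSimplex K) (i : Fin K) :
    ∑ j ∈ Finset.univ.erase i, x j = 1 - x i := by
  have h := Finset.add_sum_erase Finset.univ x (Finset.mem_univ i)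
  have := hx.1.2
  linarith

theorem posSimplex.lt_one {K : ℕ} (hK : 2 ≤ K) {x : Fin K → ℝ} (hx : x ∈ posSimplex K)
    (i : Fin K) : x i < 1 := by
  have : Nontrivial (Fin K) := Fin.nontrivial_iff_two_le.2 hK
  obtain ⟨j, hj⟩ := exists_ne i
  have h := Finset.single_le_sum (f := x) (fun k _ => hx.1.1 k)
    (Finset.mem_erase.2 ⟨hj, Finset.mem_univ j⟩)
  rw [posSimplex.sum_erase hx] at h
  linarith [hx.2 j]

theorem posSimplex.convex {K : ℕ} : Convex ℝ (posSimplex K) := by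
  intro x hx y hy a b ha hb hab
  refine ⟨convex_stdSimplex ℝ _ hx.1 hy.1 ha hb hab, fun i => ?_⟩
  have hxi := hx.2 i
  have hyi := hy.2 i
  simp only [Pi.add_apply, Pi.smul_apply, smul_eq_mul]
  rcases ha.eq_or_lt with rfl | ha
  · have : b = 1 := by linarith
    subst this; simpa using hyi
  · positivity

theorem sub_two_mul_sq_le_log_one_add {s : ℝ} (hs : -(1 / 2) ≤ s) :
    s - 2 * s ^ 2 ≤ Real.log (1 + s) := by
  have h1 : (0 : ℝ) < 1 + s := by linarith
  have h2 := Real.one_sub_inv_le_log_of_pos h1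
  have h3 : s - 2 * s ^ 2 ≤ 1 - (1 + s)⁻¹ := by
    have : 1 - (1 + s)⁻¹ - (s - 2 * s ^ 2) = s ^ 2 * (1 + 2 * s) / (1 + s) := by
      field_simp; ring
    have h4 : 0 ≤ s ^ 2 * (1 + 2 * s) / (1 + s) := by
      apply div_nonneg (mul_nonneg (sq_nonneg s) (by linarith)) h1.le
    linarith
  linarith

/-- The first-order optimality condition of the FTRL minimizer. -/
theorem IsFTRL.first_order {K : ℕ} {S : ℝ} {L x z : Fin K → ℝ} (hx : IsFTRL S L x)
    (hz : z ∈ posSimplex K) : 0 ≤ ∑ j, (L j - S / x j) * (z j - x j) := by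
  set φ : ℝ → ℝ := fun e => objective S L (fun j => x j + e * (z j - x j)) with hφ
  have hd : HasDerivAt φ (∑ j, (L j - S / x j) * (z j - x j)) 0 := by
    have hlin : ∀ j, HasDerivAt (fun e : ℝ => x j + e * (z j - x j)) (z j - x j) 0 := by
      intro j
      simpa using ((hasDerivAt_id (0 : ℝ)).mul_const (z j - x j)).const_add (x j)
    have h1 : HasDerivAt (fun e : ℝ => ∑ j, L j * (x j + e * (z j - x j)))
        (∑ j, L j * (z j - x j)) 0 :=
      HasDerivAt.fun_sum fun j _ => (hlin j).const_mul (L j)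
    have h2 : HasDerivAt (fun e : ℝ => ∑ j, Real.log (x j + e * (z j - x j)))
        (∑ j, (z j - x j) / x j) 0 := by
      refine HasDerivAt.fun_sum fun j _ => ?_
      have := (hlin j).log (by simpa using (hx.1.2 j).ne')
      simpa using this
    have e : ∑ j, (L j - S / x j) * (z j - x j)
        = ∑ j, L j * (z j - x j) + -S * ∑ j, (z j - x j) / x j := by
      rw [Finset.mul_sum, ← Finset.sum_add_distrib]
      exact Finset.sum_congr rfl fun j _ => by ring
    rw [e]
    exact h1.add (h2.const_mul (-S))
  have ht := (hasDerivAt_iff_tendsto_slope_zero.1 hd).mono_left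
    (nhdsWithin_mono (0 : ℝ) (fun y (hy : y ∈ Set.Ioi (0 : ℝ)) => (ne_of_gt hy : y ≠ 0)))
  refine ge_of_tendsto ht ?_
  filter_upwards [Ioc_mem_nhdsGT (zero_lt_one (α := ℝ))] with e he
  have hmem : (fun j => x j + e * (z j - x j)) ∈ posSimplex K := by
    have := posSimplex.convex hx.1 hz (sub_nonneg.2 he.2) he.1.le (by ring)
    convert this using 1
    funext j
    simp only [Pi.add_apply, Pi.smul_apply, smul_eq_mul]; ring
  have h0 : φ 0 = objective S L x := by simp [hφ]
  have := hx.2 _ hmem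
  have he0 := he.1
  rw [smul_eq_mul, zero_add, h0]
  exact mul_nonneg (by positivity) (sub_nonneg.2 this)

/-- The objective exceeds its minimum by at least the Bregman divergence of the log-barrier. -/
theorem IsFTRL.bregman_le {K : ℕ} {S : ℝ} {L x z : Fin K → ℝ} (hx : IsFTRL S L x)
    (hz : z ∈ posSimplex K) :
    objective S L x + S * ∑ j, (z j / x j - 1 - Real.log (z j / x j)) ≤ objective S L z := by
  have h := hx.first_order hz
  have key : objective S L z - objective S L x - S * ∑ j, (z j / x j - 1 - Real.log (z j / x j))
      = ∑ j, (L j - S / x j) * (z j - x j) := by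
    unfold objective
    simp only [Finset.mul_sum, ← Finset.sum_add_distrib, ← Finset.sum_sub_distrib]
    refine Finset.sum_congr rfl fun j _ => ?_
    rw [Real.log_div (hz.2 j).ne' (hx.1.2 j).ne']
    have := (hx.1.2 j).ne'
    field_simp; ring
  linarith

/-- A linear perturbation of one coordinate of the barrier lowers its minimum only by a quadratic
amount. -/
theorem neg_two_mul_sq_div_le {S w u : ℝ} (hS : 0 < S) (hw : |w| ≤ S / 4) (hu : 0 < u) :
    -(2 * w ^ 2 / S) ≤ S * (u - 1 - Real.log u) + w * (u - 1) := by
  obtain ⟨s, rfl⟩ : ∃ s, w = S * s := ⟨w / S, by field_simp⟩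
  have hs : |s| ≤ 1 / 4 := by
    rw [abs_mul, abs_of_pos hS] at hw
    nlinarith
  have hs1 := (abs_le.1 hs).1
  have h1 := sub_two_mul_sq_le_log_one_add (s := s) (by linarith)
  have hs0 : (0 : ℝ) < 1 + s := by linarith
  -- the minimum over `u` is attained at `u = (1 + s)⁻¹`, where the tangent is taken
  have h2 := Real.log_le_sub_one_of_pos (mul_pos hu hs0)
  rw [Real.log_mul hu.ne' hs0.ne'] at h2
  have h3 : -(2 * s ^ 2) ≤ u - 1 - Real.log u + s * (u - 1) := by nlinarith
  have h4 := mul_le_mul_of_nonneg_left h3 hS.le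
  have h5 : -(2 * (S * s) ^ 2 / S) = S * -(2 * s ^ 2) := by field_simp
  rw [h5]; linarith

/-- Stability of the FTRL minimizer: feeding the importance-weighted loss `l` of arm `i` lowers the
minimum by at most `l + O(l² (1 - x i)² / S)`. The factor `(1 - x i)²` comes from a shift of all
losses by `l`, which does not matter on the simplex. -/
theorem IsFTRL.stability {K : ℕ} {S : ℝ} (hS : 0 < S) {L x z : Fin K → ℝ} (hx : IsFTRL S L x)
    (hz : z ∈ posSimplex K) {i : Fin K} {l : ℝ} (hl : |l| * (1 - x i) ≤ S / 4) :
    objective S L x + l - 4 * (l ^ 2 * (1 - x i) ^ 2) / S ≤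
      objective S L z + l / x i * z i := by
  have hb := hx.bregman_le hz
  set u : Fin K → ℝ := fun j => z j / x j with hu
  have hupos : ∀ j, 0 < u j := fun j => div_pos (hz.2 j) (hx.1.2 j)
  have hxi := posSimplex.le_one hx.1 i
  have hsum : ∑ j, x j * (u j - 1) = 0 := by
    have h : ∀ j, x j * (u j - 1) = z j - x j := fun j => by
      have := (hx.1.2 j).ne'
      simp only [hu]; field_simp
    simp only [h, Finset.sum_sub_distrib, hz.1.2, hx.1.1.2, sub_self]
  have hsplit : ∀ f : Fin K → ℝ, ∑ j, f j = f i + ∑ j ∈ Finset.univ.erase i, f j := fun f =>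
    (Finset.add_sum_erase _ _ (Finset.mem_univ i)).symm
  have hi : -(2 * (l * (1 - x i)) ^ 2 / S) ≤
      S * (u i - 1 - Real.log (u i)) + l * (1 - x i) * (u i - 1) := by
    refine neg_two_mul_sq_div_le hS ?_ (hupos i)
    rwa [abs_mul, abs_of_nonneg (sub_nonneg.2 hxi)]
  have hle : ∀ j ∈ Finset.univ.erase i, x j ≤ 1 - x i := fun j hj => by
    rw [← posSimplex.sum_erase hx.1 i]
    exact Finset.single_le_sum (f := x) (fun k _ => hx.1.1.1 k) hj
  have hj : ∑ j ∈ Finset.univ.erase i, -(2 * (l ^ 2 * (1 - x i)) / S * x j) ≤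
      ∑ j ∈ Finset.univ.erase i, (S * (u j - 1 - Real.log (u j)) - l * (x j * (u j - 1))) := by
    refine Finset.sum_le_sum fun j hj => ?_
    have hxj := hle j hj
    have hx0 := hx.1.2 j
    have h1 : |(-(l * x j))| ≤ S / 4 := by
      rw [abs_neg, abs_mul, abs_of_pos hx0]
      exact (mul_le_mul_of_nonneg_left hxj (abs_nonneg l)).trans hl
    have h2 := neg_two_mul_sq_div_le hS h1 (hupos j)
    have h3 : 2 * (-(l * x j)) ^ 2 / S ≤ 2 * (l ^ 2 * (1 - x i)) / S * x j := by
      rw [div_mul_eq_mul_div]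
      refine div_le_div_of_nonneg_right ?_ hS.le
      have := mul_le_mul_of_nonneg_left hxj (mul_nonneg (sq_nonneg l) hx0.le)
      nlinarith
    linarith
  rw [Finset.sum_neg_distrib, ← Finset.mul_sum, posSimplex.sum_erase hx.1, Finset.sum_sub_distrib,
    ← Finset.mul_sum, ← Finset.mul_sum] at hj
  rw [hsplit] at hsum
  have e1 : 2 * (l ^ 2 * (1 - x i)) / S * (1 - x i) = 2 * (l * (1 - x i)) ^ 2 / S := by ring
  have e2 : 4 * (l ^ 2 * (1 - x i) ^ 2) / S
      = 2 * (l * (1 - x i)) ^ 2 / S + 2 * (l * (1 - x i)) ^ 2 / S := by ring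
  have e3 : l / x i * z i = l * u i := by simp only [hu]; ring
  have e4 : ∑ j ∈ Finset.univ.erase i, x j * (u j - 1) = - (x i * (u i - 1)) := by linarith
  rw [e1, e4] at hj
  rw [hsplit] at hb
  rw [e2, e3]
  have hb' : objective S L x + (S * (u i - 1 - Real.log (u i)) +
    S * ∑ j ∈ Finset.univ.erase i, (u j - 1 - Real.log (u j))) ≤ objective S L z := by
    rw [← mul_add]; exact hb
  linarith

/-! ### Skipping and clipping -/

theorem abs_clip_le {l C : ℝ} (hC : 0 ≤ C) : |clip l C| ≤ C := by
  unfold clip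
  split_ifs with h1 h2
  · exact (abs_of_nonneg hC).le
  · rw [abs_neg, abs_of_nonneg hC]
  · exact abs_le.2 ⟨by linarith, by linarith⟩

theorem abs_clip_le_abs {l C : ℝ} (hC : 0 ≤ C) : |clip l C| ≤ |l| := by
  unfold clip
  split_ifs with h1 h2
  · rw [abs_of_nonneg hC]; exact h1.trans (le_abs_self l)
  · rw [abs_neg, abs_of_nonneg hC]; linarith [neg_abs_le l]
  · exact le_rfl

theorem clip_sq_of_le_abs {l C : ℝ} (h : C ≤ |l|) : clip l C ^ 2 = C ^ 2 := by
  unfold clip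
  split_ifs with h1 h2
  · rfl
  · ring
  · rcases le_abs.1 h with h | h
    · exact absurd h h1
    · exact absurd (by linarith) h2

theorem abs_skip_le {l C : ℝ} (hC : 0 ≤ C) : |skip l C| ≤ C := by
  unfold skip
  split_ifs with h
  · exact h.le
  · simpa using hC

theorem abs_skip_le_abs {l C : ℝ} : |skip l C| ≤ |l| := by
  unfold skip
  split_ifs with h
  · exact le_rfl
  · simp

theorem skip_sq_le_clip_sq {l C : ℝ} : skip l C ^ 2 ≤ clip l C ^ 2 := by
  unfold skip
  split_ifs with h
  · obtain ⟨h1, h2⟩ := abs_lt.1 h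
    rw [clip, if_neg h2.not_ge, if_neg h1.not_ge]
  · simpa using sq_nonneg _

/-! ### The game along a fixed sequence of observations -/

/-- The scale `K log T` by which the learning rate update is normalized. -/
noncomputable def scale (K T : ℕ) : ℝ := K * Real.log T

theorem one_le_scale {K T : ℕ} (hK : 2 ≤ K) (hT : 2 ≤ T) : 1 ≤ scale K T := by
  have h1 : (2 : ℝ) ≤ K := by exact_mod_cast hK
  have h2 : Real.log 2 ≤ Real.log T := Real.log_le_log (by norm_num) (by exact_mod_cast hT)
  have h3 := Real.log_two_gt_d9
  unfold scale
  nlinarith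

section Game

variable {K T : ℕ} {obs : ℕ → Fin K × ℝ}

theorem four_le_S (t : ℕ) : 4 ≤ (state T obs t).S := by
  induction t with
  | zero => exact le_rfl
  | succ t ih =>
    refine Real.le_sqrt_of_sq_le ?_
    have h1 : (4 : ℝ) ^ 2 ≤ (state T obs t).S ^ 2 := by gcongr
    refine h1.trans (le_add_of_nonneg_right ?_)
    have := Real.log_natCast_nonneg T
    positivity

theorem S_pos (t : ℕ) : 0 < (state T obs t).S := by linarith [four_le_S (T := T) (obs := obs) t]

theorem S_succ_sq (t : ℕ) : (state T obs (t + 1)).S ^ 2 = (state T obs t).S ^ 2 +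
    clip (obs t).2 ((state T obs t).C (obs t).1) ^ 2 * (1 - (state T obs t).x (obs t).1) ^ 2
      * (scale K T)⁻¹ := by
  refine Real.sq_sqrt ?_
  have := Real.log_natCast_nonneg T
  positivity

theorem S_le_S_succ (t : ℕ) : (state T obs t).S ≤ (state T obs (t + 1)).S := by
  refine Real.le_sqrt_of_sq_le (le_add_of_nonneg_right ?_)
  have := Real.log_natCast_nonneg T
  positivity

theorem isFTRL_x (hK : 2 ≤ K) (t : ℕ) :
    IsFTRL (state T obs t).S (state T obs t).L (state T obs t).x :=
  ftrl_spec (by omega) (S_pos t) _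

theorem x_pos (hK : 2 ≤ K) (t : ℕ) (i : Fin K) : 0 < (state T obs t).x i :=
  (isFTRL_x hK t).1.2 i

theorem x_lt_one (hK : 2 ≤ K) (t : ℕ) (i : Fin K) : (state T obs t).x i < 1 :=
  posSimplex.lt_one hK (isFTRL_x hK t).1 i

theorem C_mul (hK : 2 ≤ K) (t : ℕ) (i : Fin K) :
    (state T obs t).C i * (1 - (state T obs t).x i) = (state T obs t).S / 4 := by
  have := sub_pos.2 (x_lt_one (T := T) (obs := obs) hK t i)
  unfold State.C
  field_simp

theorem S_div_four_le_C (hK : 2 ≤ K) (t : ℕ) (i : Fin K) :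
    (state T obs t).S / 4 ≤ (state T obs t).C i := by
  have h1 := sub_pos.2 (x_lt_one (T := T) (obs := obs) hK t i)
  have h2 := x_pos (T := T) (obs := obs) hK t i
  have h3 := S_pos (T := T) (obs := obs) t
  unfold State.C
  gcongr
  linarith

theorem C_pos (hK : 2 ≤ K) (t : ℕ) (i : Fin K) : 0 < (state T obs t).C i :=
  (div_pos (S_pos t) (by norm_num)).trans_le (S_div_four_le_C hK t i)

theorem S_succ_le_two_mul (hK : 2 ≤ K) (hT : 2 ≤ T) (t : ℕ) :
    (state T obs (t + 1)).S ≤ 2 * (state T obs t).S := by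
  have hS := S_pos (T := T) (obs := obs) t
  refine abs_le_of_sq_le_sq' ?_ (by positivity) |>.2
  rw [S_succ_sq]
  have h1 : clip (obs t).2 ((state T obs t).C (obs t).1) ^ 2 *
      (1 - (state T obs t).x (obs t).1) ^ 2 ≤ ((state T obs t).S / 4) ^ 2 := by
    rw [← mul_pow, ← C_mul hK t (obs t).1]
    refine sq_le_sq' ?_ ?_
    all_goals
      have h := abs_le.1 (abs_clip_le (l := (obs t).2) (C_pos (T := T) (obs := obs) hK t (obs t).1).le)
      have h' := sub_pos.2 (x_lt_one (T := T) (obs := obs) hK t (obs t).1)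
      nlinarith
  have h2 : (scale K T)⁻¹ ≤ 1 := inv_le_one_of_one_le₀ (one_le_scale hK hT)
  have h3 : 0 ≤ (scale K T)⁻¹ := inv_nonneg.2 (zero_le_one.trans (one_le_scale hK hT))
  nlinarith [mul_le_mul h1 h2 h3 (by positivity), sq_nonneg (state T obs t).S]

theorem S_le_two_pow (hK : 2 ≤ K) (hT : 2 ≤ T) (t : ℕ) :
    (state T obs t).S ≤ 4 * 2 ^ t := by
  induction t with
  | zero => simp [state]
  | succ t ih =>
    have := S_succ_le_two_mul (obs := obs) hK hT t
    rw [pow_succ]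
    linarith

/-- The loss of the played arm in round `t`, as it enters the estimate. -/
noncomputable def skipped (T : ℕ) (obs : ℕ → Fin K × ℝ) (t : ℕ) : ℝ :=
  skip (obs t).2 ((state T obs t).C (obs t).1)

/-- The stability cost of a round is paid for by the growth of `S`. -/
theorem stability_cost_le (hK : 2 ≤ K) (hT : 2 ≤ T) (t : ℕ) :
    4 * (skipped T obs t ^ 2 * (1 - (state T obs t).x (obs t).1) ^ 2) / (state T obs t).S
      ≤ 12 * scale K T * ((state T obs (t + 1)).S - (state T obs t).S) := by
  have hS := S_pos (T := T) (obs := obs) t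
  have hN := one_le_scale hK hT
  have h1 : skipped T obs t ^ 2 * (1 - (state T obs t).x (obs t).1) ^ 2
      ≤ scale K T * ((state T obs (t + 1)).S ^ 2 - (state T obs t).S ^ 2) := by
    rw [S_succ_sq]
    have h2 : skipped T obs t ^ 2 * (1 - (state T obs t).x (obs t).1) ^ 2 ≤
        clip (obs t).2 ((state T obs t).C (obs t).1) ^ 2 *
          (1 - (state T obs t).x (obs t).1) ^ 2 :=
      mul_le_mul_of_nonneg_right skip_sq_le_clip_sq (sq_nonneg _)
    refine h2.trans (le_of_eq ?_)
    have : scale K T ≠ 0 := by positivity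
    field_simp
    ring
  rw [div_le_iff₀ hS]
  have h3 := S_succ_le_two_mul (obs := obs) hK hT t
  have h4 := S_le_S_succ (T := T) (obs := obs) t
  have h5 : (state T obs (t + 1)).S ^ 2 - (state T obs t).S ^ 2 ≤
      3 * (((state T obs (t + 1)).S - (state T obs t).S) * (state T obs t).S) := by nlinarith
  nlinarith [mul_le_mul_of_nonneg_left h5 (zero_le_one.trans hN)]

/-- The FTRL potential argument: the estimated losses of the player are bounded by the minimum of
the current objective, up to the accumulated stability cost. -/
theorem sum_skipped_le_objective (hK : 2 ≤ K) (hT : 2 ≤ T) (n : ℕ) :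
    ∑ t ∈ Finset.range n, skipped T obs t - 12 * scale K T * ((state T obs n).S - 4)
      ≤ objective (state T obs n).S (state T obs n).L (state T obs n).x := by
  have hlog : ∀ n, ∑ i, Real.log ((state T obs n).x i) ≤ 0 := fun n =>
    Finset.sum_nonpos fun i _ => Real.log_nonpos (x_pos hK n i).le (x_lt_one hK n i).le
  induction n with
  | zero =>
    have := hlog 0
    have e : (state T obs 0).S = 4 := rfl
    have e' : (state T obs 0).L = fun _ => 0 := rfl
    simp only [Finset.range_zero, Finset.sum_empty, objective, e, e', zero_mul,
      Finset.sum_const_zero]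
    linarith
  | succ n ih =>
    have hstab := (isFTRL_x (T := T) (obs := obs) hK n).stability (S_pos n)
      (isFTRL_x (T := T) (obs := obs) hK (n + 1)).1 (i := (obs n).1) (l := skipped T obs n) (by
        rw [← C_mul hK n (obs n).1]
        exact mul_le_mul_of_nonneg_right (abs_skip_le (C_pos hK n _).le)
          (sub_nonneg.2 (x_lt_one hK n _).le))
    have hcost := stability_cost_le (obs := obs) hK hT n
    have hL : ∑ i, (state T obs (n + 1)).L i * (state T obs (n + 1)).x i =
        ∑ i, (state T obs n).L i * (state T obs (n + 1)).x i +
          skipped T obs n / (state T obs n).x (obs n).1 * (state T obs (n + 1)).x (obs n).1 := by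
      have : ∀ i, (state T obs (n + 1)).L i = (state T obs n).L i +
        (if i = (obs n).1 then skipped T obs n / (state T obs n).x (obs n).1 else 0) :=
        fun i => rfl
      simp only [this, add_mul, Finset.sum_add_distrib, ite_mul, zero_mul, Finset.sum_ite_eq',
        Finset.mem_univ, if_true]
    rw [Finset.sum_range_succ]
    have h1 := hlog (n + 1)
    have h2 := S_le_S_succ (T := T) (obs := obs) n
    have h3 := mul_nonneg (sub_nonneg.2 h2) (neg_nonneg.2 h1)
    unfold objective at *
    rw [hL]
    linarith

/-- The regret of FTRL on the loss estimates, against a fixed `y` in the interior of the simplex. -/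
theorem sum_skipped_sub_le (hK : 2 ≤ K) (hT : 2 ≤ T) {y : Fin K → ℝ} (hy : y ∈ posSimplex K)
    (n : ℕ) :
    ∑ t ∈ Finset.range n, (skipped T obs t -
        skipped T obs t / (state T obs t).x (obs t).1 * y (obs t).1)
      ≤ (state T obs n).S * (12 * scale K T - ∑ i, Real.log (y i)) := by
  have h1 := (isFTRL_x (T := T) (obs := obs) hK n).2 y hy
  have h2 := sum_skipped_le_objective (obs := obs) hK hT n
  have hL : ∑ i, (state T obs n).L i * y i = ∑ t ∈ Finset.range n,
      skipped T obs t / (state T obs t).x (obs t).1 * y (obs t).1 := by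
    clear h1 h2
    induction n with
    | zero => simp [state]
    | succ n ih =>
      have : ∀ i, (state T obs (n + 1)).L i = (state T obs n).L i +
        (if i = (obs n).1 then skipped T obs n / (state T obs n).x (obs n).1 else 0) :=
        fun i => rfl
      simp only [this, add_mul, Finset.sum_add_distrib, ite_mul, zero_mul, Finset.sum_ite_eq',
        Finset.mem_univ, if_true]
      rw [ih, Finset.sum_range_succ]
  rw [Finset.sum_sub_distrib]
  have hN := one_le_scale hK hT
  have h3 := h2.trans h1
  rw [objective, hL] at h3
  nlinarith

/-- The vertex `b` of the simplex, moved by `1 / T` towards the uniform distribution: its barrier is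
finite, and the move costs only `O(σ)` of regret in total. -/
noncomputable def comparator (K T : ℕ) (b : Fin K) : Fin K → ℝ :=
  fun i => (1 - 1 / (T : ℝ)) * (if i = b then 1 else 0) + 1 / (T : ℝ) * (1 / (K : ℝ))

theorem comparator_ge (hT : 2 ≤ T) (b i : Fin K) :
    1 / (T : ℝ) * (1 / (K : ℝ)) ≤ comparator K T b i := by
  have h : (0 : ℝ) ≤ 1 - 1 / (T : ℝ) := by
    have : (2 : ℝ) ≤ T := by exact_mod_cast hT
    rw [sub_nonneg, div_le_one (by linarith)]; linarith
  unfold comparator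
  have : (0 : ℝ) ≤ if i = b then 1 else 0 := by split_ifs <;> norm_num
  nlinarith

theorem comparator_mem (hK : 2 ≤ K) (hT : 2 ≤ T) (b : Fin K) :
    comparator K T b ∈ posSimplex K := by
  have hK0 : (0 : ℝ) < K := by exact_mod_cast (by omega : 0 < K)
  have hT0 : (0 : ℝ) < T := by exact_mod_cast (by omega : 0 < T)
  have hpos : ∀ i, 0 < comparator K T b i := fun i =>
    lt_of_lt_of_le (by positivity) (comparator_ge hT b i)
  refine ⟨⟨fun i => (hpos i).le, ?_⟩, hpos⟩
  simp only [comparator, Finset.sum_add_distrib, ← Finset.mul_sum]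
  simp
  field_simp
  ring

theorem neg_sum_log_comparator_le (hK : 2 ≤ K) (hT : 2 ≤ T) (hKT : K ≤ T) (b : Fin K) :
    -∑ i, Real.log (comparator K T b i) ≤ 2 * scale K T := by
  have hK0 : (0 : ℝ) < K := by exact_mod_cast (by omega : 0 < K)
  have hT0 : (0 : ℝ) < T := by exact_mod_cast (by omega : 0 < T)
  have hlog : Real.log K ≤ Real.log T := Real.log_le_log hK0 (by exact_mod_cast hKT)
  have h : ∀ i, -(2 * Real.log T) ≤ Real.log (comparator K T b i) := fun i => by
    refine le_trans ?_ (Real.log_le_log (by positivity) (comparator_ge hT b i))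
    rw [Real.log_mul (by positivity) (by positivity), Real.log_div one_ne_zero hT0.ne',
      Real.log_div one_ne_zero hK0.ne', Real.log_one]
    linarith
  have := Finset.sum_le_sum fun i (_ : i ∈ Finset.univ) => h i
  simp only [Finset.sum_const, Finset.card_univ, Fintype.card_fin, nsmul_eq_mul] at this
  unfold scale
  linarith

theorem sum_skipped_sub_comparator_le (hK : 2 ≤ K) (hT : 2 ≤ T) (hKT : K ≤ T) (b : Fin K) (n : ℕ) :
    ∑ t ∈ Finset.range n, (skipped T obs t -
        skipped T obs t / (state T obs t).x (obs t).1 * comparator K T b (obs t).1)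
      ≤ 14 * scale K T * (state T obs n).S := by
  refine (sum_skipped_sub_le hK hT (comparator_mem hK hT b) n).trans ?_
  have := neg_sum_log_comparator_le hK hT hKT b
  have hS := S_pos (T := T) (obs := obs) n
  nlinarith

/-! ### Growth of the learning rate -/

/-- A skipped loss is clipped to the threshold, so it multiplies `S ^ 2` by `1 + 1 / (16 K log T)`.
-/
theorem log_S_succ_ge (hK : 2 ≤ K) (hT : 2 ≤ T) {t : ℕ}
    (h : (state T obs t).C (obs t).1 ≤ |(obs t).2|) :
    Real.log (state T obs t).S + 1 / (34 * scale K T) ≤ Real.log (state T obs (t + 1)).S := by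
  have hS := S_pos (T := T) (obs := obs) t
  have hS' := S_pos (T := T) (obs := obs) (t + 1)
  have hN := one_le_scale hK hT
  have h1 := S_succ_sq (T := T) (obs := obs) t
  rw [clip_sq_of_le_abs h, ← mul_pow, C_mul hK] at h1
  have h2 : (state T obs (t + 1)).S ^ 2
      = (state T obs t).S ^ 2 * (1 + 1 / (16 * scale K T)) := by
    rw [h1]; field_simp; ring
  have h3 := congrArg Real.log h2
  rw [Real.log_mul (by positivity) (by positivity), Real.log_pow, Real.log_pow] at h3
  have h4 := Real.one_sub_inv_le_log_of_pos
    (show (0 : ℝ) < 1 + 1 / (16 * scale K T) by positivity)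
  -- `32` would do in the limit; `34` leaves room since `1 ≤ K log T`
  have h5 : 2 * (1 / (34 * scale K T)) ≤ 1 - (1 + 1 / (16 * scale K T))⁻¹ := by
    have e : 1 - (1 + 1 / (16 * scale K T))⁻¹ = 1 / (16 * scale K T + 1) := by
      field_simp; ring
    rw [e, mul_one_div, div_le_div_iff₀ (by positivity) (by positivity)]
    linarith
  push_cast at h3
  linarith

/-- Only few rounds skip a loss of size at most `M`: each of them multiplies `S` by a constant
factor and can occur only while `S ≤ 4 M`. -/
theorem card_skip_le (hK : 2 ≤ K) (hT : 2 ≤ T) {M : ℝ} (n : ℕ) :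
    ∑ t ∈ Finset.range n,
        (if (state T obs t).C (obs t).1 ≤ |(obs t).2| ∧ |(obs t).2| ≤ M then (1 : ℝ) else 0)
      ≤ 1 + 34 * scale K T * max 0 (Real.log M) := by
  have hN := one_le_scale hK hT
  -- the bound by the growth of `log S` so far is what the last skipped round is compared with
  suffices h : ∑ t ∈ Finset.range n,
        (if (state T obs t).C (obs t).1 ≤ |(obs t).2| ∧ |(obs t).2| ≤ M then (1 : ℝ) else 0)
      ≤ 1 + 34 * scale K T * max 0 (Real.log M) ∧
      ∑ t ∈ Finset.range n,
        (if (state T obs t).C (obs t).1 ≤ |(obs t).2| ∧ |(obs t).2| ≤ M then (1 : ℝ) else 0)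
      ≤ 34 * scale K T * (Real.log (state T obs n).S - Real.log 4) from h.1
  induction n with
  | zero =>
    simp only [Finset.range_zero, Finset.sum_empty]
    refine ⟨by positivity, ?_⟩
    have e : (state T obs 0).S = 4 := rfl
    rw [e, sub_self, mul_zero]
  | succ n ih =>
    obtain ⟨ih1, ih2⟩ := ih
    rw [Finset.sum_range_succ]
    split_ifs with h
    · have h1 := log_S_succ_ge hK hT h.1
      have hS := S_pos (T := T) (obs := obs) n
      have hC := S_div_four_le_C (T := T) (obs := obs) hK n (obs n).1
      have hlog : Real.log (state T obs n).S - Real.log 4 ≤ Real.log M := by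
        rw [← Real.log_div hS.ne' (by norm_num)]
        exact Real.log_le_log (by positivity) (hC.trans (h.1.trans h.2))
      have h2 : 34 * scale K T * (1 / (34 * scale K T)) = 1 := by field_simp
      have h3 : 34 * scale K T * (Real.log (state T obs n).S + 1 / (34 * scale K T)) ≤
        34 * scale K T * Real.log (state T obs (n + 1)).S := by gcongr
      have h4 : 34 * scale K T * (Real.log (state T obs n).S - Real.log 4) ≤
        34 * scale K T * max 0 (Real.log M) := by gcongr; exact hlog.trans (le_max_right _ _)
      constructor <;> linarith
    · have h2 := S_le_S_succ (T := T) (obs := obs) n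
      have h3 := Real.log_le_log (S_pos n) h2
      rw [add_zero]
      refine ⟨ih1, ih2.trans ?_⟩
      gcongr

/-- The growth of `S ^ α` is governed by the `α`-th powers of the losses, because clipping keeps the
increment of `S ^ 2` below `S ^ 2`. The exponent of `1 - x` is lowered from `α` to `1`. -/
theorem S_rpow_le (hK : 2 ≤ K) (hT : 2 ≤ T) {α : ℝ} (h1 : 1 < α) (h2 : α ≤ 2) (n : ℕ) :
    (state T obs n).S ^ α ≤ 4 ^ α + ∑ t ∈ Finset.range n,
      |(obs t).2| ^ α * (1 - (state T obs t).x (obs t).1) * (scale K T)⁻¹ := by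
  have hN := one_le_scale hK hT
  induction n with
  | zero => simp [state]
  | succ n ih =>
    rw [Finset.sum_range_succ, ← add_assoc]
    refine le_trans ?_ (add_le_add_left ih _)
    have hS := S_pos (T := T) (obs := obs) n
    have hS' := S_pos (T := T) (obs := obs) (n + 1)
    have hle := S_le_S_succ (T := T) (obs := obs) n
    set S := (state T obs n).S
    set S' := (state T obs (n + 1)).S
    set x := (state T obs n).x (obs n).1 with hx
    set l := (obs n).2
    have hx0 : 0 < x := x_pos hK n _
    have hx1 : x < 1 := x_lt_one hK n _
    have hCp := C_pos (T := T) (obs := obs) hK n (obs n).1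
    set a := |clip l ((state T obs n).C (obs n).1)| * (1 - x) with ha
    have ha0 : 0 ≤ a := mul_nonneg (abs_nonneg _) (by linarith)
    have hsq : S' ^ 2 = S ^ 2 + a ^ 2 * (scale K T)⁻¹ := by
      rw [S_succ_sq, ha, mul_pow, sq_abs]
    have haS : a ≤ S' := by
      have : a ≤ S / 4 := by
        rw [← C_mul hK n (obs n).1]
        exact mul_le_mul_of_nonneg_right (abs_clip_le hCp.le) (by linarith)
      linarith
    have hal : a ^ α ≤ |l| ^ α * (1 - x) := by
      rw [ha, Real.mul_rpow (abs_nonneg _) (by linarith)]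
      have e1 : |clip l ((state T obs n).C (obs n).1)| ^ α ≤ |l| ^ α :=
        Real.rpow_le_rpow (abs_nonneg _) (abs_clip_le_abs hCp.le) (by linarith)
      have e2 : (1 - x) ^ α ≤ 1 - x := by
        have := Real.rpow_le_rpow_of_exponent_ge (show 0 < 1 - x by linarith) (by linarith) h1.le
        simpa using this
      exact mul_le_mul e1 e2 (by positivity) (by positivity)
    -- divide the recursion of the squares by `S' ^ (2 - α)`
    have hpow : ∀ y : ℝ, 0 ≤ y → y ≤ S' → y ^ 2 * S' ^ (α - 2) ≤ y ^ α := by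
      intro y hy hyS
      rcases hy.eq_or_lt with rfl | hy
      · simp [Real.zero_rpow (by linarith : α ≠ 0)]
      have : S' ^ (α - 2) ≤ y ^ (α - 2) :=
        Real.rpow_le_rpow_of_nonpos hy hyS (by linarith)
      calc y ^ 2 * S' ^ (α - 2) ≤ y ^ 2 * y ^ (α - 2) := by gcongr
        _ = y ^ α := by
          rw [← Real.rpow_natCast y 2, ← Real.rpow_add hy]; congr 1; push_cast; ring
    have e3 : S' ^ α = S' ^ 2 * S' ^ (α - 2) := by
      rw [← Real.rpow_natCast S' 2, ← Real.rpow_add hS']; congr 1; push_cast; ring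
    rw [e3, hsq, add_mul]
    have e4 := hpow S hS.le hle
    have e5 := (hpow a ha0 haS).trans hal
    have e6 := mul_le_mul_of_nonneg_right e5 (inv_nonneg.2 (zero_le_one.trans hN))
    linarith

end Game

/-! ### Measurability of the algorithm -/

/-- The Lagrange multiplier `S / x i - L i` of the simplex constraint takes the same value at all
coordinates: apply the inequality in both directions. -/
theorem IsFTRL.multiplier_le {K : ℕ} {S : ℝ} {L x : Fin K → ℝ} (hx : IsFTRL S L x)
    (i j : Fin K) : S / x i - L i ≤ S / x j - L j := by
  rcases eq_or_ne i j with rfl | hij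
  · exact le_rfl
  -- move mass from `j` to `i`
  have hxj := hx.1.2 j
  have hxi := hx.1.2 i
  set z : Fin K → ℝ := fun k => x k + x j / 2 * ((if k = i then 1 else 0) - if k = j then 1 else 0)
  have hz : z ∈ posSimplex K := by
    have hpos : ∀ k, 0 < z k := by
      intro k
      have hk := hx.1.2 k
      simp only [z]
      by_cases hkj : k = j
      · subst hkj; simp [hij.symm]; linarith
      · by_cases hki : k = i
        · simp [hki, hij]; positivity
        · simp [hkj, hki, hk]
    refine ⟨⟨fun k => (hpos k).le, ?_⟩, hpos⟩
    simp [z, Finset.sum_add_distrib, ← Finset.mul_sum, hx.1.1.2]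
  have h := hx.first_order hz
  have e : ∑ k, (L k - S / x k) * (z k - x k) =
      x j / 2 * ((L i - S / x i) - (L j - S / x j)) := by
    simp only [z, add_sub_cancel_left]
    simp only [mul_sub, mul_ite, mul_one, mul_zero, Finset.sum_sub_distrib, Finset.sum_ite_eq',
      Finset.mem_univ, if_true]
    ring
  rw [e] at h
  have := nonneg_of_mul_nonneg_right h (by positivity)
  linarith

/-- The FTRL minimizer is `S / (L i + c)`, where the sublevel sets `{c < q}` of the multiplier are
described by the inequality `∑ j, S / (L j + q) < 1`. -/
theorem measurable_ftrl {K : ℕ} {Ω : Type*} [MeasurableSpace Ω] {S : Ω → ℝ} {L : Ω → Fin K → ℝ}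
    (hS : Measurable S) (hL : ∀ i, Measurable fun ω => L ω i) (hpos : ∀ ω, 0 < S ω) (i : Fin K) :
    Measurable fun ω => ftrl (S ω) (L ω) i := by
  have hK : 0 < K := i.pos
  have hx : ∀ ω, IsFTRL (S ω) (L ω) (ftrl (S ω) (L ω)) := fun ω => ftrl_spec hK (hpos ω) _
  set x : Ω → Fin K → ℝ := fun ω => ftrl (S ω) (L ω)
  set c : Ω → ℝ := fun ω => S ω / x ω i - L ω i with hc
  have hadd : ∀ ω j, L ω j + c ω = S ω / x ω j := fun ω j => by
    have := le_antisymm ((hx ω).multiplier_le i j) ((hx ω).multiplier_le j i)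
    simp only [hc]; linarith
  have hdiv : ∀ ω j, x ω j = S ω / (L ω j + c ω) := fun ω j => by
    rw [hadd, div_div_cancel₀ (hpos ω).ne']
  have haddpos : ∀ ω j, 0 < L ω j + c ω := fun ω j => by
    rw [hadd]; exact div_pos (hpos ω) ((hx ω).1.2 j)
  have hcm : Measurable c := by
    refine measurable_of_Iio fun q => ?_
    have hset : c ⁻¹' Set.Iio q =
        {ω | (∀ j, 0 < L ω j + q) ∧ ∑ j, S ω / (L ω j + q) < 1} := by
      ext ω
      simp only [Set.mem_preimage, Set.mem_Iio, Set.mem_ofPred_eq]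
      refine ⟨fun h => ⟨fun j => by linarith [haddpos ω j], ?_⟩, fun ⟨h1, h2⟩ => ?_⟩
      · rw [← (hx ω).1.1.2]
        refine Finset.sum_lt_sum_of_nonempty ⟨i, Finset.mem_univ i⟩ fun j _ => ?_
        show _ < x ω j
        rw [hdiv]
        exact div_lt_div_of_pos_left (hpos ω) (haddpos ω j) (by linarith)
      · by_contra! h
        refine h2.not_ge ?_
        rw [← (hx ω).1.1.2]
        refine Finset.sum_le_sum fun j _ => ?_
        show x ω j ≤ _
        rw [hdiv]
        exact div_le_div_of_nonneg_left (hpos ω).le (h1 j) (by linarith)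
    rw [hset]
    refine MeasurableSet.inter ?_ ?_
    · have : {ω | ∀ j, 0 < L ω j + q} = ⋂ j, {ω | 0 < L ω j + q} := by ext; simp
      change MeasurableSet {ω | ∀ j, 0 < L ω j + q}
      rw [this]
      exact MeasurableSet.iInter fun j => measurableSet_lt measurable_const ((hL j).add_const q)
    · exact measurableSet_lt (Finset.measurable_fun_sum _ fun j _ => hS.div ((hL j).add_const q))
        measurable_const
  have : (fun ω => ftrl (S ω) (L ω) i) = fun ω => S ω / (L ω i + c ω) := funext fun ω => hdiv ω i
  rw [this]
  exact hS.div ((hL i).add hcm)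

theorem measurable_clip : Measurable fun p : ℝ × ℝ => clip p.1 p.2 := by
  unfold clip
  exact Measurable.ite (measurableSet_le measurable_snd measurable_fst) measurable_snd
    (Measurable.ite (measurableSet_le measurable_fst measurable_snd.neg) measurable_snd.neg
      measurable_fst)

theorem measurable_skip : Measurable fun p : ℝ × ℝ => skip p.1 p.2 := by
  unfold skip
  exact Measurable.ite (measurableSet_lt measurable_fst.abs measurable_snd) measurable_fst
    measurable_const

theorem measurable_apply_index {K : ℕ} {Ω : Type*} [MeasurableSpace Ω] {f : Ω → Fin K → ℝ}
    (hf : ∀ i, Measurable fun ω => f ω i) {a : Ω → Fin K} (ha : Measurable a) :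
    Measurable fun ω => f ω (a ω) := by
  have : (fun ω => f ω (a ω)) = fun ω => ∑ i, if a ω = i then f ω i else 0 := by
    funext ω; simp
  rw [this]
  exact Finset.measurable_fun_sum _ fun i _ =>
    Measurable.ite (ha (measurableSet_singleton i)) (hf i) measurable_const

section Measurability

variable {K : ℕ} {Ω : Type*}

theorem measurable_State_C [MeasurableSpace Ω] {s : Ω → State K}
    (hS : Measurable fun ω => (s ω).S) (hx : ∀ i, Measurable fun ω => (s ω).x i) (i : Fin K) :
    Measurable fun ω => (s ω).C i :=
  hS.div (((hx i).const_sub 1).const_mul 4)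

theorem measurable_next [MeasurableSpace Ω] (T : ℕ) {s : Ω → State K} {i : Ω → Fin K} {l : Ω → ℝ}
    (hS : Measurable fun ω => (s ω).S) (hL : ∀ i, Measurable fun ω => (s ω).L i)
    (hpos : ∀ ω, 0 < (s ω).S) (hi : Measurable i) (hl : Measurable l) :
    (Measurable fun ω => ((s ω).next T (i ω) (l ω)).S) ∧
      ∀ j, Measurable fun ω => ((s ω).next T (i ω) (l ω)).L j := by
  have hx : ∀ j, Measurable fun ω => (s ω).x j := fun j => measurable_ftrl hS hL hpos j
  have hxi : Measurable fun ω => (s ω).x (i ω) := measurable_apply_index hx hi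
  have hCi : Measurable fun ω => (s ω).C (i ω) :=
    measurable_apply_index (fun j => measurable_State_C hS hx j) hi
  constructor
  · exact ((hS.pow_const 2).add ((((measurable_clip.comp (hl.prodMk hCi)).pow_const 2).mul
      ((hxi.const_sub 1).pow_const 2)).mul_const _)).sqrt
  · intro j
    refine (hL j).add ?_
    have hset : MeasurableSet {ω | j = i ω} := by
      have : {ω | j = i ω} = i ⁻¹' {j} := by ext; simp [eq_comm]
      rw [this]; exact hi (measurableSet_singleton j)
    exact Measurable.ite hset ((measurable_skip.comp (hl.prodMk hCi)).div hxi) measurable_const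

/-- The σ-algebra of the observations made before round `t`. -/
abbrev past (loss : ℕ → Ω → Fin K → ℝ) (arm : ℕ → Ω → Fin K) (t : ℕ) : MeasurableSpace Ω :=
  MeasurableSpace.comap (history loss arm t) inferInstance

theorem past_le_succ (loss : ℕ → Ω → Fin K → ℝ) (arm : ℕ → Ω → Fin K) (t : ℕ) :
    past loss arm t ≤ past loss arm (t + 1) := by
  have : history loss arm t = (fun h (s : Fin t) => h s.castSucc) ∘ history loss arm (t + 1) := rfl
  unfold past
  rw [this, ← MeasurableSpace.comap_comp]
  refine MeasurableSpace.comap_mono (Measurable.comap_le ?_)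
  exact measurable_pi_lambda _ fun s => measurable_pi_apply _

theorem measurable_obs_past (loss : ℕ → Ω → Fin K → ℝ) (arm : ℕ → Ω → Fin K) (t : ℕ) :
    Measurable[past loss arm (t + 1)] fun ω => obs loss arm ω t :=
  (measurable_pi_apply (Fin.last t)).comp (comap_measurable (history loss arm (t + 1)))

theorem measurable_state_past (T : ℕ) (loss : ℕ → Ω → Fin K → ℝ) (arm : ℕ → Ω → Fin K) (t : ℕ) :
    (Measurable[past loss arm t] fun ω => (state T (obs loss arm ω) t).S) ∧
      ∀ j, Measurable[past loss arm t] fun ω => (state T (obs loss arm ω) t).L j := by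
  induction t with
  | zero => exact ⟨measurable_const, fun _ => measurable_const⟩
  | succ t ih =>
    have hle := past_le_succ loss arm t
    have ho := measurable_obs_past loss arm t
    exact @measurable_next K Ω (past loss arm (t + 1)) T _ _ _ (ih.1.mono hle le_rfl)
      (fun j => (ih.2 j).mono hle le_rfl) (fun ω => S_pos t) (measurable_fst.comp ho)
      (measurable_snd.comp ho)

theorem measurable_x_past (T : ℕ) (loss : ℕ → Ω → Fin K → ℝ) (arm : ℕ → Ω → Fin K) (t : ℕ)
    (j : Fin K) : Measurable[past loss arm t] fun ω => (state T (obs loss arm ω) t).x j :=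
  @measurable_ftrl K Ω (past loss arm t) _ _ (measurable_state_past T loss arm t).1
    (measurable_state_past T loss arm t).2 (fun _ => S_pos t) j

theorem measurable_C_past (T : ℕ) (loss : ℕ → Ω → Fin K → ℝ) (arm : ℕ → Ω → Fin K) (t : ℕ)
    (j : Fin K) : Measurable[past loss arm t] fun ω => (state T (obs loss arm ω) t).C j :=
  @measurable_State_C K Ω (past loss arm t) _ (measurable_state_past T loss arm t).1
    (measurable_x_past T loss arm t) j

end Measurability

/-! ### Sampling an arm and drawing its loss -/

section Sampling

variable {Ω : Type*} {m mΩ : MeasurableSpace Ω} {P : Measure Ω} [IsProbabilityMeasure P]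

/-- If the event `B` has conditional probability `p` given `m`, and the loss `Y` is independent of
the pair of `m` and `B`, then on `B` the joint law of `Y` and any `m`-measurable `c` is a product,
with `c` weighted by `p`. -/
theorem map_restrict_eq_prod (hm : m ≤ mΩ) {B : Set Ω}
    (hB : MeasurableSet B) {p : Ω → ℝ} (hp0 : ∀ ω, 0 ≤ p ω)
    (hcond : P⟦B | m⟧ =ᵐ[P] p) {Y : Ω → ℝ} (hY : Measurable Y)
    (hind : ∀ A, MeasurableSet[m] A → ∀ s, MeasurableSet s →
      P (Y ⁻¹' s ∩ (A ∩ B)) = P (Y ⁻¹' s) * P (A ∩ B))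
    {E : Type*} [MeasurableSpace E] {c : Ω → E} (hc : Measurable[m] c) :
    (P.restrict B).map (fun ω => (c ω, Y ω)) =
      ((P.withDensity fun ω => ENNReal.ofReal (p ω)).map c).prod (P.map Y) := by
  have hpint : Integrable p P := integrable_condExp.congr hcond
  have : IsFiniteMeasure (P.withDensity fun ω => ENNReal.ofReal (p ω)) :=
    isFiniteMeasure_withDensity_ofReal hpint.2
  have : IsProbabilityMeasure (P.map Y) := Measure.isProbabilityMeasure_map hY.aemeasurable
  have hcm : Measurable c := hc.mono hm le_rfl
  symm
  refine Measure.prod_eq fun s u hs hu => ?_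
  have hs' : MeasurableSet[m] (c ⁻¹' s) := hc hs
  rw [Measure.map_apply (hcm.prodMk hY) (hs.prod hu), Measure.restrict_apply
    ((hcm.prodMk hY) (hs.prod hu)), Measure.map_apply hcm hs, Measure.map_apply hY hu,
    withDensity_apply _ (hcm hs)]
  have e : (fun ω => (c ω, Y ω)) ⁻¹' s ×ˢ u ∩ B = Y ⁻¹' u ∩ (c ⁻¹' s ∩ B) := by
    ext ω; simp only [Set.mem_inter_iff, Set.mem_preimage, Set.mem_prod]; tauto
  rw [e, hind _ hs' u hu, mul_comm]
  congr 1
  rw [← ofReal_integral_eq_lintegral_ofReal hpint.integrableOn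
    (Filter.Eventually.of_forall hp0)]
  have h1 := setIntegral_condExp hm
    ((integrable_const (1 : ℝ)).indicator hB : Integrable (B.indicator fun _ => (1 : ℝ)) P) hs'
  have h2 : ∫ ω in c ⁻¹' s, (P⟦B | m⟧) ω ∂P = ∫ ω in c ⁻¹' s, p ω ∂P :=
    integral_congr_ae (ae_restrict_of_ae hcond)
  rw [← h2, h1, setIntegral_indicator hB, setIntegral_const, smul_eq_mul, mul_one, measureReal_def,
    ENNReal.ofReal_toReal (measure_ne_top _ _)]

/-- The expectation of `g (c, Y)` on the event `B`. The domination hypothesis involves `p * |g|`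
only, so that `g` may contain the importance weight `1 / p`, which need not be bounded. -/
theorem setIntegral_sample (hm : m ≤ mΩ) {B : Set Ω}
    (hB : MeasurableSet B) {p : Ω → ℝ} (hp : Measurable[m] p) (hp0 : ∀ ω, 0 ≤ p ω)
    (hcond : P⟦B | m⟧ =ᵐ[P] p) {Y : Ω → ℝ} (hY : Measurable Y)
    (hind : ∀ A, MeasurableSet[m] A → ∀ s, MeasurableSet s →
      P (Y ⁻¹' s ∩ (A ∩ B)) = P (Y ⁻¹' s) * P (A ∩ B))
    {E : Type*} [MeasurableSpace E] {c : Ω → E} (hc : Measurable[m] c)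
    {g : E × ℝ → ℝ} (hg : Measurable g) {h : ℝ → ℝ} (hh : Integrable h (P.map Y))
    (hbd : ∀ ω y, p ω * |g (c ω, y)| ≤ h y) :
    Integrable (B.indicator fun ω => g (c ω, Y ω)) P ∧
      Integrable (fun ω => p ω * ∫ y, g (c ω, y) ∂(P.map Y)) P ∧
      ∫ ω, B.indicator (fun ω => g (c ω, Y ω)) ω ∂P =
        ∫ ω, p ω * ∫ y, g (c ω, y) ∂(P.map Y) ∂P := by
  have hmap := map_restrict_eq_prod hm hB hp0 hcond hY hind hc
  have hcm : Measurable c := hc.mono hm le_rfl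
  have hpm : Measurable p := hp.mono hm le_rfl
  have hpint : Integrable p P := integrable_condExp.congr hcond
  have : IsFiniteMeasure (P.withDensity fun ω => ENNReal.ofReal (p ω)) :=
    isFiniteMeasure_withDensity_ofReal hpint.2
  have : IsProbabilityMeasure (P.map Y) := Measure.isProbabilityMeasure_map hY.aemeasurable
  have hint : Integrable g
      (((P.withDensity fun ω => ENNReal.ofReal (p ω)).map c).prod (P.map Y)) := by
    refine ⟨hg.aestronglyMeasurable, ?_⟩
    rw [hasFiniteIntegral_iff_enorm, lintegral_prod _ hg.enorm.aemeasurable,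
      lintegral_map hg.enorm.lintegral_prod_right' hcm]
    refine (lintegral_withDensity_eq_lintegral_mul P hpm.ennreal_ofReal
      (hg.enorm.lintegral_prod_right'.comp hcm)).trans_lt ?_
    calc ∫⁻ ω, ENNReal.ofReal (p ω) * ∫⁻ y, ‖g (c ω, y)‖ₑ ∂(P.map Y) ∂P
        ≤ ∫⁻ _, ∫⁻ y, ‖h y‖ₑ ∂(P.map Y) ∂P := by
          refine lintegral_mono fun ω => ?_
          dsimp only
          rw [← lintegral_const_mul' _ _ ENNReal.ofReal_ne_top]
          refine lintegral_mono fun y => ?_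
          rw [Real.enorm_eq_ofReal_abs, Real.enorm_eq_ofReal_abs,
            ← ENNReal.ofReal_mul (hp0 ω)]
          exact ENNReal.ofReal_le_ofReal ((hbd ω y).trans (le_abs_self _))
      _ < ⊤ := by
          rw [lintegral_const, measure_univ, mul_one]
          exact hh.2
  have hint' : Integrable (fun ω => g (c ω, Y ω)) (P.restrict B) := by
    rw [← hmap] at hint
    exact hint.comp_measurable (hcm.prodMk hY)
  have hdens : ∀ f : Ω → ℝ, ∫ ω, f ω ∂(P.withDensity fun ω => ENNReal.ofReal (p ω)) =
      ∫ ω, p ω * f ω ∂P := fun f => by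
    rw [integral_withDensity_eq_integral_toReal_smul hpm.ennreal_ofReal
      (Filter.Eventually.of_forall fun _ => ENNReal.ofReal_lt_top)]
    simp only [ENNReal.toReal_ofReal (hp0 _), smul_eq_mul]
  have hG := hint.integral_prod_left
  have hG' := hG.comp_measurable hcm
  refine ⟨(integrable_indicator_iff hB).2 hint', ?_, ?_⟩
  · rw [integrable_withDensity_iff hpm.ennreal_ofReal
      (Filter.Eventually.of_forall fun _ => ENNReal.ofReal_lt_top)] at hG'
    refine hG'.congr (Filter.Eventually.of_forall fun ω => ?_)
    simp only [ENNReal.toReal_ofReal (hp0 _), Function.comp, mul_comm]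
  · rw [integral_indicator hB, ← integral_map (hcm.prodMk hY).aemeasurable
      hg.aestronglyMeasurable, hmap, integral_prod _ hint,
      integral_map hcm.aemeasurable hG.aestronglyMeasurable, hdens]

end Sampling

section Run

variable {K T : ℕ} {Ω : Type*} [MeasurableSpace Ω] {P : Measure Ω} {ν : ℕ → Fin K → Measure ℝ}
  {loss : ℕ → Ω → Fin K → ℝ} {arm : ℕ → Ω → Fin K}

theorem IsRun.measurable_loss_apply (hrun : IsRun T ν P loss arm) {t : ℕ} (ht : t < T)
    (i : Fin K) : Measurable fun ω => loss t ω i :=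
  (measurable_pi_apply i).comp (hrun.measurable_loss t ht)

theorem IsRun.measurable_history (hrun : IsRun T ν P loss arm) {t : ℕ} (ht : t ≤ T) :
    Measurable (history loss arm t) :=
  measurable_pi_lambda _ fun s =>
    have hs : (s : ℕ) < T := s.2.trans_le ht
    (hrun.measurable_arm s hs).prodMk
      (measurable_apply_index (hrun.measurable_loss_apply hs) (hrun.measurable_arm s hs))

theorem IsRun.past_le (hrun : IsRun T ν P loss arm) {t : ℕ} (ht : t ≤ T) :
    past loss arm t ≤ (inferInstance : MeasurableSpace Ω) :=
  (hrun.measurable_history ht).comap_le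

theorem IsRun.isProbabilityMeasure [IsProbabilityMeasure P] (hrun : IsRun T ν P loss arm) {t : ℕ}
    (ht : t < T) (i : Fin K) : IsProbabilityMeasure (ν t i) := by
  rw [← hrun.law_loss t ht i]
  exact Measure.isProbabilityMeasure_map (hrun.measurable_loss_apply ht i).aemeasurable

/-- The expectation of a function `g` of the played arm, its probability, its threshold and its loss
is obtained by averaging over the arm and then over the loss distribution of that arm. -/
theorem IsRun.integral_round [IsProbabilityMeasure P] (hrun : IsRun T ν P loss arm) (hK : 2 ≤ K)
    {t : ℕ} (ht : t < T) {g : Fin K → ℝ → ℝ → ℝ → ℝ}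
    (hg : ∀ j, Measurable fun q : (ℝ × ℝ) × ℝ => g j q.1.1 q.1.2 q.2) {h : ℝ → ℝ}
    (hh : ∀ j, Integrable h (ν t j))
    (hbd : ∀ j x c y, 0 < x → x < 1 → x * |g j x c y| ≤ h y) :
    Integrable (fun ω => g (arm t ω) ((state T (obs loss arm ω) t).x (arm t ω))
        ((state T (obs loss arm ω) t).C (arm t ω)) (loss t ω (arm t ω))) P ∧
      Integrable (fun ω => ∑ j, (state T (obs loss arm ω) t).x j *
        ∫ y, g j ((state T (obs loss arm ω) t).x j) ((state T (obs loss arm ω) t).C j) y ∂ν t j) P ∧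
      ∫ ω, g (arm t ω) ((state T (obs loss arm ω) t).x (arm t ω))
          ((state T (obs loss arm ω) t).C (arm t ω)) (loss t ω (arm t ω)) ∂P =
        ∫ ω, ∑ j, (state T (obs loss arm ω) t).x j *
          ∫ y, g j ((state T (obs loss arm ω) t).x j)
            ((state T (obs loss arm ω) t).C j) y ∂ν t j ∂P := by
  have key := fun j =>
    setIntegral_sample (hrun.past_le ht.le) (hrun.measurable_arm t ht (measurableSet_singleton j))
      (measurable_x_past T loss arm t j) (fun ω => (x_pos hK t j).le) (hrun.sample_arm t ht j)
      (hrun.measurable_loss_apply ht j)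
      (by
        rintro A ⟨A', hA', rfl⟩ s hs
        have := (hrun.indep_loss t ht).measure_inter_preimage_eq_mul {v | v j ∈ s} (A' ×ˢ {j})
          (measurable_pi_apply j hs) (hA'.prod (measurableSet_singleton j))
        rw [Set.mk_preimage_prod] at this
        exact this)
      ((measurable_x_past T loss arm t j).prodMk (measurable_C_past T loss arm t j)) (hg j)
      (by rw [hrun.law_loss t ht j]; exact hh j)
      (fun ω y => hbd j _ _ y (x_pos hK t j) (x_lt_one hK t j))
  simp only [hrun.law_loss t ht] at key
  have e : (fun ω => g (arm t ω) ((state T (obs loss arm ω) t).x (arm t ω))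
        ((state T (obs loss arm ω) t).C (arm t ω)) (loss t ω (arm t ω))) =
      fun ω => ∑ j, (arm t ⁻¹' {j}).indicator (fun ω => g j ((state T (obs loss arm ω) t).x j)
        ((state T (obs loss arm ω) t).C j) (loss t ω j)) ω := by
    classical
    funext ω
    have : ∀ j, ω ∈ arm t ⁻¹' {j} ↔ arm t ω = j := fun j => Iff.rfl
    simp only [Set.indicator_apply, this, Finset.sum_ite_eq, Finset.mem_univ, if_true]
  rw [e, integral_finsetSum _ fun j _ => (key j).1, integral_finsetSum _ fun j _ => (key j).2.1]
  exact ⟨integrable_finsetSum _ fun j _ => (key j).1, integrable_finsetSum _ fun j _ => (key j).2.1,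
    Finset.sum_congr rfl fun j _ => (key j).2.2⟩

end Run

/-! ### Heavy-tailed distributions -/

/-- A truncated non-negative loss stays non-negative in mean when the threshold itself is cut off
as well. -/
theorem TruncatedNonneg.integral_sub_skip_nonneg {ν : Measure ℝ} (h : TruncatedNonneg ν)
    (hν : Integrable (fun l : ℝ => l) ν) {C : ℝ} (hC : 0 < C) :
    0 ≤ ∫ l, (l - skip l C) ∂ν := by
  have hmeas : ∀ n : ℕ, MeasurableSet {l : ℝ | C - C / (n + 1) < |l|} := fun n =>
    measurableSet_lt measurable_const measurable_id.abs
  have hanti : Antitone fun n : ℕ => {l : ℝ | C - C / ((n : ℝ) + 1) < |l|} := by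
    intro m n hmn l hl
    have : C / ((n : ℝ) + 1) ≤ C / ((m : ℝ) + 1) := by gcongr
    have hl' : C - C / ((n : ℝ) + 1) < |l| := hl
    exact lt_of_le_of_lt (by linarith) hl'
  have hlim := tendsto_setIntegral_of_antitone (μ := ν) (f := fun l : ℝ => l) hmeas hanti
    ⟨0, hν.integrableOn⟩
  have hinter : (⋂ n : ℕ, {l : ℝ | C - C / ((n : ℝ) + 1) < |l|}) = {l : ℝ | C ≤ |l|} := by
    ext l
    simp only [Set.mem_iInter]
    refine ⟨fun hl => ?_, fun hl n => ?_⟩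
    · have ht : Filter.Tendsto (fun n : ℕ => C - C * (1 / ((n : ℝ) + 1))) Filter.atTop
          (nhds (C - C * 0)) :=
        tendsto_const_nhds.sub (tendsto_one_div_add_atTop_nhds_zero_nat.const_mul C)
      rw [mul_zero, sub_zero] at ht
      refine le_of_tendsto ht (Filter.Eventually.of_forall fun n => ?_)
      rw [mul_one_div]
      exact le_of_lt (hl n)
    · have : 0 < C / ((n : ℝ) + 1) := by positivity
      exact lt_of_lt_of_le (sub_lt_self C this) hl
  rw [hinter] at hlim
  have hset : MeasurableSet {l : ℝ | C ≤ |l|} := measurableSet_le measurable_const measurable_id.abs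
  have e : (fun l => l - skip l C) = Set.indicator {l : ℝ | C ≤ |l|} fun l => l := by
    funext l
    by_cases hl : C ≤ |l|
    · rw [Set.indicator_of_mem (show l ∈ {l : ℝ | C ≤ |l|} from hl), skip, if_neg hl.not_gt,
        sub_zero]
    · rw [Set.indicator_of_notMem (show l ∉ {l : ℝ | C ≤ |l|} from hl), skip,
        if_pos (not_le.1 hl), sub_self]
  rw [e, integral_indicator hset]
  refine ge_of_tendsto hlim (Filter.Eventually.of_forall fun n => h _ ?_)
  have : C / ((n : ℝ) + 1) ≤ C := div_le_self hC.le (by linarith [n.cast_nonneg (α := ℝ)])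
  linarith

section HeavyTail

variable {α σ : ℝ} {ν : Measure ℝ} [IsProbabilityMeasure ν]

theorem HeavyTailed.integrable_abs (h : HeavyTailed α σ ν) (hα : 1 < α) :
    Integrable (fun l : ℝ => |l|) ν := by
  refine (h.1.add (integrable_const (1 : ℝ))).mono' measurable_id.abs.aestronglyMeasurable
    (Filter.Eventually.of_forall fun l => ?_)
  rw [Real.norm_eq_abs, abs_abs, Pi.add_apply]
  rcases le_total |l| 1 with h1 | h1
  · have : (0 : ℝ) ≤ |l| ^ α := by positivity
    linarith
  · have := Real.rpow_le_rpow_of_exponent_le h1 hα.le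
    rw [Real.rpow_one] at this
    linarith

theorem HeavyTailed.integrable_id (h : HeavyTailed α σ ν) (hα : 1 < α) :
    Integrable (fun l : ℝ => l) ν :=
  (integrable_norm_iff measurable_id.aestronglyMeasurable).1 (h.integrable_abs hα)

theorem HeavyTailed.integral_abs_le (h : HeavyTailed α σ ν) (hα : 1 < α) (hσ : 0 ≤ σ) :
    ∫ l, |l| ∂ν ≤ σ := by
  have h1 := (convexOn_rpow hα.le).map_integral_le (μ := ν) (f := fun l : ℝ => |l|)
    (continuousOn_id.rpow_const fun _ _ => Or.inr (by linarith)) isClosed_Ici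
    (Filter.Eventually.of_forall fun l => abs_nonneg l) (h.integrable_abs hα) h.1
  exact (Real.rpow_le_rpow_iff (integral_nonneg fun _ => abs_nonneg _) hσ (by linarith)).1
    (h1.trans h.2)

theorem HeavyTailed.abs_integral_le (h : HeavyTailed α σ ν) (hα : 1 < α) (hσ : 0 ≤ σ)
    {f : ℝ → ℝ} (hf : ∀ l, |f l| ≤ |l|) : |∫ l, f l ∂ν| ≤ σ := by
  have h1 := norm_integral_le_of_norm_le (μ := ν) (f := f) (h.integrable_abs hα)
    (Filter.Eventually.of_forall hf)
  exact h1.trans (h.integral_abs_le hα hσ)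

theorem HeavyTailed.integrable_skip (h : HeavyTailed α σ ν) (hα : 1 < α) (C : ℝ) :
    Integrable (fun l => skip l C) ν :=
  (h.integrable_abs hα).mono' (measurable_skip.comp (measurable_id.prodMk
    measurable_const)).aestronglyMeasurable (Filter.Eventually.of_forall fun _ => abs_skip_le_abs)

/-- The tail of the loss beyond the threshold `C`: losses above `M` are controlled by the moment. -/
theorem HeavyTailed.integral_abs_sub_skip_le (h : HeavyTailed α σ ν) (hα : 1 < α) {C M : ℝ}
    (hM : 0 < M) :
    ∫ l, |l - skip l C| ∂ν ≤
      M * (∫ l, (if C ≤ |l| ∧ |l| ≤ M then (1 : ℝ) else 0) ∂ν) + σ ^ α * M ^ (1 - α) := by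
  have hset : MeasurableSet {l : ℝ | C ≤ |l| ∧ |l| ≤ M} :=
    (measurableSet_le measurable_const measurable_id.abs).inter
      (measurableSet_le measurable_id.abs measurable_const)
  have hI : Integrable (fun l : ℝ => if C ≤ |l| ∧ |l| ≤ M then (1 : ℝ) else 0) ν :=
    Integrable.of_bound (Measurable.ite hset measurable_const measurable_const).aestronglyMeasurable
      1 (Filter.Eventually.of_forall fun l => by split_ifs <;> simp)
  have hpt : ∀ l : ℝ, |l - skip l C| ≤
      M * (if C ≤ |l| ∧ |l| ≤ M then (1 : ℝ) else 0) + |l| ^ α * M ^ (1 - α) := by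
    intro l
    have hpos : 0 ≤ |l| ^ α * M ^ (1 - α) := by positivity
    unfold skip
    split_ifs with h1 h2 h2
    · linarith [h2.1]
    · simpa using hpos
    · rw [sub_zero]; linarith [h2.2]
    · have h3 : M < |l| := by
        by_contra! h4
        exact h2 ⟨not_lt.1 h1, h4⟩
      have h4 : |l| ^ (1 - α) ≤ M ^ (1 - α) :=
        Real.rpow_le_rpow_of_nonpos hM h3.le (by linarith)
      have h5 : |l| ^ α * |l| ^ (1 - α) = |l| := by
        rw [← Real.rpow_add (hM.trans h3)]; simp
      have h6 : |l| ^ α * |l| ^ (1 - α) ≤ |l| ^ α * M ^ (1 - α) := by gcongr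
      rw [sub_zero]; linarith
  calc ∫ l, |l - skip l C| ∂ν
      ≤ ∫ l, (M * (if C ≤ |l| ∧ |l| ≤ M then (1 : ℝ) else 0) + |l| ^ α * M ^ (1 - α)) ∂ν :=
        integral_mono ((h.integrable_id hα).sub (h.integrable_skip hα C)).abs
          ((hI.const_mul M).add (h.1.mul_const _)) hpt
    _ ≤ _ := by
        rw [integral_add (hI.const_mul M) (h.1.mul_const _), integral_const_mul,
          integral_mul_const]
        have := mul_le_mul_of_nonneg_right h.2 (Real.rpow_nonneg hM.le (1 - α))
        linarith

/-- The regret in one round against arm `b`, when the player samples from `x` and has the thresholds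
`C`: the regret on the skipped losses against the smoothed comparator, the error of the comparator
and the skipping error. The latter does not involve arm `b`, whose losses are truncated
non-negative. -/
theorem round_regret_le {K T : ℕ} (hK : 2 ≤ K) (hT : 2 ≤ T) (hα : 1 < α) (hσ : 0 ≤ σ)
    {ν : Fin K → Measure ℝ} [∀ j, IsProbabilityMeasure (ν j)] (hν : ∀ j, HeavyTailed α σ (ν j))
    {b : Fin K} (hb : TruncatedNonneg (ν b)) {x C : Fin K → ℝ} (hx : x ∈ posSimplex K)
    (hC : ∀ j, 0 < C j) {M : ℝ} (hM : 0 < M) :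
    ∑ j, x j * ∫ l, l ∂ν j - ∫ l, l ∂ν b ≤
      ∑ j, x j * ∫ l, (skip l (C j) - skip l (C j) / x j * comparator K T b j) ∂ν j
      + 2 * σ / T
      + M * ∑ j, x j * ∫ l, (if C j ≤ |l| ∧ |l| ≤ M then (1 : ℝ) else 0) ∂ν j
      + σ ^ α * M ^ (1 - α) * (1 - x b) := by
  set y := comparator K T b with hy
  set μ : Fin K → ℝ := fun j => ∫ l, l ∂ν j
  set m : Fin K → ℝ := fun j => ∫ l, skip l (C j) ∂ν j with hm
  set r : Fin K → ℝ := fun j => ∫ l, (l - skip l (C j)) ∂ν j with hr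
  set q : Fin K → ℝ := fun j => ∫ l, (if C j ≤ |l| ∧ |l| ≤ M then (1 : ℝ) else 0) ∂ν j
  have hq0 : ∀ j, 0 ≤ q j := fun j => integral_nonneg fun l => by
    dsimp only; split_ifs <;> norm_num
  have hμ : ∀ j, μ j = m j + r j := fun j => by
    simp only [hr, hm, μ]
    rw [integral_sub ((hν j).integrable_id hα) ((hν j).integrable_skip hα _)]
    ring
  have h1 : ∑ j, x j * ∫ l, (skip l (C j) - skip l (C j) / x j * y j) ∂ν j
      = ∑ j, (x j - y j) * m j := by
    refine Finset.sum_congr rfl fun j _ => ?_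
    have e : ∀ l, skip l (C j) - skip l (C j) / x j * y j = (1 - y j / x j) * skip l (C j) :=
      fun l => by ring
    simp only [e, integral_const_mul]
    have := (hx.2 j).ne'
    simp only [hm]
    field_simp
  have hmσ : ∀ j, |m j| ≤ σ := fun j =>
    (hν j).abs_integral_le hα hσ fun _ => abs_skip_le_abs
  have hT0 : (0 : ℝ) < T := by exact_mod_cast (by omega : 0 < T)
  have hK0 : (0 : ℝ) < K := by exact_mod_cast (by omega : 0 < K)
  have h2 : ∑ j, y j * m j - m b ≤ 2 * σ / T := by
    have e : ∑ j, y j * m j = (1 - 1 / (T : ℝ)) * m b + 1 / T * (1 / K * ∑ j, m j) := by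
      simp only [hy, comparator, add_mul, Finset.sum_add_distrib, mul_ite, mul_one, mul_zero,
        ite_mul, zero_mul, Finset.sum_ite_eq', Finset.mem_univ, if_true, mul_assoc, Finset.mul_sum]
    have h3 : 1 / K * ∑ j, m j ≤ σ := by
      have := Finset.sum_le_card_nsmul Finset.univ m σ fun j _ => (abs_le.1 (hmσ j)).2
      rw [Finset.card_univ, Fintype.card_fin, nsmul_eq_mul] at this
      rw [one_div_mul_eq_div, div_le_iff₀ hK0]
      linarith
    have h4 := (abs_le.1 (hmσ b)).1
    have e2 : 2 * σ / T = 1 / (T : ℝ) * (σ + σ) := by ring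
    have h5 : 1 / (T : ℝ) * (1 / K * ∑ j, m j - m b) ≤ 1 / (T : ℝ) * (σ + σ) := by
      gcongr; linarith
    rw [e, e2]
    linarith
  have hrb : 0 ≤ r b := hb.integral_sub_skip_nonneg ((hν b).integrable_id hα) (hC b)
  have hrj : ∀ j, r j ≤ M * q j + σ ^ α * M ^ (1 - α) := fun j =>
    ((le_abs_self _).trans abs_integral_le_integral_abs).trans
      ((hν j).integral_abs_sub_skip_le hα hM)
  have h6 : ∑ j ∈ Finset.univ.erase b, x j * r j ≤
      M * ∑ j, x j * q j + σ ^ α * M ^ (1 - α) * (1 - x b) := by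
    calc ∑ j ∈ Finset.univ.erase b, x j * r j
        ≤ ∑ j ∈ Finset.univ.erase b, (M * (x j * q j) + σ ^ α * M ^ (1 - α) * x j) := by
          refine Finset.sum_le_sum fun j _ => ?_
          have := mul_le_mul_of_nonneg_left (hrj j) (hx.2 j).le
          linarith
      _ ≤ _ := by
          rw [Finset.sum_add_distrib, ← Finset.mul_sum, ← Finset.mul_sum,
            posSimplex.sum_erase hx]
          refine add_le_add (mul_le_mul_of_nonneg_left ?_ hM.le) le_rfl
          refine Finset.sum_le_sum_of_subset_of_nonneg (Finset.erase_subset b Finset.univ)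
            fun j _ _ => ?_
          exact mul_nonneg (hx.2 j).le (hq0 j)
  have h7 : ∑ j, x j * r j ≤ r b + ∑ j ∈ Finset.univ.erase b, x j * r j := by
    rw [← Finset.add_sum_erase _ _ (Finset.mem_univ b)]
    have := mul_le_mul_of_nonneg_right (posSimplex.le_one hx b) hrb
    linarith
  have h8 : ∑ j, x j * μ j = ∑ j, (x j - y j) * m j + ∑ j, y j * m j + ∑ j, x j * r j := by
    rw [← Finset.sum_add_distrib, ← Finset.sum_add_distrib]
    refine Finset.sum_congr rfl fun j _ => ?_
    rw [hμ]; ring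
  rw [h1]
  change ∑ j, x j * μ j - μ b ≤ _
  rw [h8, hμ b]
  linarith

end HeavyTail

/-! ### The regret in expectation -/

section Expectation

variable {K T : ℕ} {α σ : ℝ} {Ω : Type*} [MeasurableSpace Ω] {P : Measure Ω}
  {ν : ℕ → Fin K → Measure ℝ} {loss : ℕ → Ω → Fin K → ℝ}
  {arm : ℕ → Ω → Fin K}

theorem IsRun.integral_loss (hrun : IsRun T ν P loss arm) {t : ℕ} (ht : t < T) (i : Fin K) :
    ∫ ω, loss t ω i ∂P = ∫ l, l ∂ν t i := by
  rw [← hrun.law_loss t ht i, integral_map (hrun.measurable_loss_apply ht i).aemeasurable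
    (f := fun l : ℝ => l) measurable_id.aestronglyMeasurable]

/-- The expected number of rounds in which an arm other than `b` is played. -/
noncomputable def exploration (T : ℕ) (P : Measure Ω)
    (loss : ℕ → Ω → Fin K → ℝ) (arm : ℕ → Ω → Fin K) (b : Fin K) : ℝ :=
  ∑ t ∈ Finset.range T, ∫ ω, (1 - (state T (obs loss arm ω) t).x b) ∂P

theorem IsRun.measurable_S (hrun : IsRun T ν P loss arm) :
    Measurable fun ω => (state T (obs loss arm ω) T).S :=
  (measurable_state_past T loss arm T).1.mono (hrun.past_le le_rfl) le_rfl

variable [IsProbabilityMeasure P]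

theorem IsRun.integrable_x (hrun : IsRun T ν P loss arm) (hK : 2 ≤ K) {t : ℕ} (ht : t ≤ T)
    (j : Fin K) : Integrable (fun ω => (state T (obs loss arm ω) t).x j) P :=
  Integrable.of_bound
    ((measurable_x_past T loss arm t j).mono (hrun.past_le ht) le_rfl).aestronglyMeasurable 1
    (Filter.Eventually.of_forall fun ω => by
      rw [Real.norm_eq_abs, abs_of_pos (x_pos hK t j)]
      exact (x_lt_one hK t j).le)

theorem IsRun.integrable_loss (hrun : IsRun T ν P loss arm) (hα : 1 < α) {t : ℕ} (ht : t < T)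
    {i : Fin K} (hν : HeavyTailed α σ (ν t i)) : Integrable (fun ω => loss t ω i) P := by
  have := hrun.isProbabilityMeasure ht i
  have h := hν.integrable_id hα
  rw [← hrun.law_loss t ht i] at h
  exact h.comp_measurable (hrun.measurable_loss_apply ht i)

theorem IsRun.integral_loss_arm (hrun : IsRun T ν P loss arm) (hK : 2 ≤ K) (hα : 1 < α)
    {t : ℕ} (ht : t < T) (hν : ∀ i, HeavyTailed α σ (ν t i)) :
    Integrable (fun ω => loss t ω (arm t ω)) P ∧
      Integrable (fun ω => ∑ j, (state T (obs loss arm ω) t).x j * ∫ l, l ∂ν t j) P ∧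
      ∫ ω, loss t ω (arm t ω) ∂P =
        ∫ ω, ∑ j, (state T (obs loss arm ω) t).x j * ∫ l, l ∂ν t j ∂P :=
  have := fun j => hrun.isProbabilityMeasure ht j
  hrun.integral_round hK ht (g := fun _ _ _ y => y) (fun _ => measurable_snd)
    (fun j => (hν j).integrable_abs hα) fun _ _ _ y _ h1 =>
      mul_le_of_le_one_left (abs_nonneg y) h1.le

/-- The expected regret against arm `i` in round `t`, with the loss of the player averaged over the
arm and over the loss distributions given the past. -/
noncomputable def roundRegret (T : ℕ) (ν : ℕ → Fin K → Measure ℝ) (P : Measure Ω)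
    (loss : ℕ → Ω → Fin K → ℝ) (arm : ℕ → Ω → Fin K) (i : Fin K) (t : ℕ) : ℝ :=
  ∫ ω, ∑ j, (state T (obs loss arm ω) t).x j * ∫ l, l ∂ν t j ∂P - ∫ l, l ∂ν t i

/-- The supremum over arms in the pseudo-regret is attained at an optimal arm. -/
theorem IsRun.regret_le (hrun : IsRun T ν P loss arm) (hK : 2 ≤ K) (hα : 1 < α)
    (hν : ∀ t < T, ∀ i, HeavyTailed α σ (ν t i)) {b : Fin K} (hb : IsOptimalArm T ν b) :
    regret T P loss arm ≤ ∑ t ∈ Finset.range T, roundRegret T ν P loss arm b t := by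
  have : Nonempty (Fin K) := ⟨b⟩
  refine ciSup_le fun i => ?_
  rw [integral_sub, integral_finsetSum, integral_finsetSum, Finset.sum_congr rfl fun t ht =>
    (hrun.integral_loss_arm hK hα (Finset.mem_range.1 ht) (hν t (Finset.mem_range.1 ht))).2.2,
    Finset.sum_congr rfl fun t ht => hrun.integral_loss (Finset.mem_range.1 ht) i]
  · have := hb i
    simp only [roundRegret, Finset.sum_sub_distrib]
    linarith
  · exact fun t ht => hrun.integrable_loss hα (Finset.mem_range.1 ht) (hν t (Finset.mem_range.1 ht) i)
  · exact fun t ht => (hrun.integral_loss_arm hK hα (Finset.mem_range.1 ht)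
      (hν t (Finset.mem_range.1 ht))).1
  · exact integrable_finsetSum _ fun t ht => (hrun.integral_loss_arm hK hα (Finset.mem_range.1 ht)
      (hν t (Finset.mem_range.1 ht))).1
  · exact integrable_finsetSum _ fun t ht =>
      hrun.integrable_loss hα (Finset.mem_range.1 ht) (hν t (Finset.mem_range.1 ht) i)

/-- The regret bound that every player satisfies. -/
theorem IsRun.sum_roundRegret_le_trivial (hrun : IsRun T ν P loss arm) (hK : 2 ≤ K) (hα : 1 < α)
    (hσ : 0 ≤ σ) (hν : ∀ t < T, ∀ i, HeavyTailed α σ (ν t i)) (b : Fin K) :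
    ∑ t ∈ Finset.range T, roundRegret T ν P loss arm b t ≤ 2 * σ * T := by
  have h : ∀ t ∈ Finset.range T, roundRegret T ν P loss arm b t ≤ 2 * σ := fun t ht => by
    have ht' := Finset.mem_range.1 ht
    have := fun j => hrun.isProbabilityMeasure ht' j
    have h1 : ∀ j, |∫ l, l ∂ν t j| ≤ σ := fun j =>
      (hν t ht' j).abs_integral_le hα hσ fun _ => le_rfl
    have h2 : ∫ ω, ∑ j, (state T (obs loss arm ω) t).x j * ∫ l, l ∂ν t j ∂P ≤ ∫ _, σ ∂P := by
      refine integral_mono (hrun.integral_loss_arm hK hα ht' (hν t ht')).2.1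
        (integrable_const σ) fun ω => ?_
      have hx := (isFTRL_x (T := T) (obs := obs loss arm ω) hK t).1
      calc ∑ j, (state T (obs loss arm ω) t).x j * ∫ l, l ∂ν t j
          ≤ ∑ j, (state T (obs loss arm ω) t).x j * σ := Finset.sum_le_sum fun j _ =>
            mul_le_mul_of_nonneg_left (abs_le.1 (h1 j)).2 (hx.2 j).le
        _ = σ := by rw [← Finset.sum_mul, hx.1.2, one_mul]
    rw [integral_const, probReal_univ, one_smul] at h2
    have := (abs_le.1 (h1 b)).1
    unfold roundRegret
    linarith
  have := Finset.sum_le_card_nsmul _ _ _ h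
  rw [Finset.card_range, nsmul_eq_mul] at this
  linarith

theorem exploration_le (hK : 2 ≤ K) (b : Fin K) : exploration T P loss arm b ≤ T := by
  have h : ∀ t ∈ Finset.range T, ∫ ω, (1 - (state T (obs loss arm ω) t).x b) ∂P ≤ 1 := fun t _ => by
    have := integral_mono_of_nonneg (μ := P) (f := fun ω => 1 - (state T (obs loss arm ω) t).x b)
      (g := fun _ => (1 : ℝ)) (Filter.Eventually.of_forall fun ω => sub_nonneg.2 (x_lt_one hK t b).le)
      (integrable_const 1)
      (Filter.Eventually.of_forall fun ω => sub_le_self _ (x_pos hK t b).le)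
    simpa using this
  have := Finset.sum_le_card_nsmul _ _ _ h
  simpa [exploration] using this

theorem IsRun.integrable_S (hrun : IsRun T ν P loss arm) (hK : 2 ≤ K) (hT : 2 ≤ T) :
    Integrable (fun ω => (state T (obs loss arm ω) T).S) P :=
  Integrable.of_bound hrun.measurable_S.aestronglyMeasurable (4 * 2 ^ T)
    (Filter.Eventually.of_forall fun ω => by
      rw [Real.norm_eq_abs, abs_of_pos (S_pos T)]
      exact S_le_two_pow hK hT T)

/-- The regret in terms of the final inverse learning rate, for any cutoff `M` in the analysis of
the skipped losses. -/
theorem IsRun.sum_roundRegret_le (hrun : IsRun T ν P loss arm) (hK : 2 ≤ K) (hT : 2 ≤ T)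
    (hKT : K ≤ T) (hα : 1 < α) (hσ : 0 ≤ σ) (hν : ∀ t < T, ∀ i, HeavyTailed α σ (ν t i))
    {b : Fin K} (hb : ∀ t < T, TruncatedNonneg (ν t b)) {M : ℝ} (hM : 0 < M) :
    ∑ t ∈ Finset.range T, roundRegret T ν P loss arm b t ≤
      14 * scale K T * ∫ ω, (state T (obs loss arm ω) T).S ∂P + 2 * σ
        + M * (1 + 34 * scale K T * max 0 (Real.log M))
        + σ ^ α * M ^ (1 - α) * exploration T P loss arm b := by
  have hT0 : (0 : ℝ) < T := by exact_mod_cast (by omega : 0 < T)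
  have hprob : ∀ t < T, ∀ j, IsProbabilityMeasure (ν t j) := fun t ht j =>
    hrun.isProbabilityMeasure ht j
  have hskip := fun t (ht : t < T) =>
    have := hprob t ht
    hrun.integral_round hK ht
      (g := fun j x c y => skip y c - skip y c / x * comparator K T b j)
      (fun j => by
        have h : Measurable fun q : (ℝ × ℝ) × ℝ => skip q.2 q.1.2 :=
          measurable_skip.comp (measurable_snd.prodMk (measurable_snd.comp measurable_fst))
        exact h.sub ((h.div (measurable_fst.comp measurable_fst)).mul_const _))
      (fun j => (hν t ht j).integrable_abs hα)
      (fun j x c y h0 h1 => by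
        have h2 := (comparator_mem hK hT b).2 j
        have h3 := posSimplex.le_one (comparator_mem hK hT b) j
        have e : x * |skip y c - skip y c / x * comparator K T b j| =
            |skip y c| * |x - comparator K T b j| := by
          rw [← abs_mul, ← abs_of_pos h0, ← abs_mul, abs_of_pos h0]
          congr 1
          field_simp
        rw [e]
        have h4 : |x - comparator K T b j| ≤ 1 := abs_le.2 ⟨by linarith, by linarith⟩
        calc |skip y c| * |x - comparator K T b j| ≤ |y| * 1 :=
              mul_le_mul abs_skip_le_abs h4 (abs_nonneg _) (abs_nonneg _)
          _ = |y| := mul_one _)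
  have hcount := fun t (ht : t < T) =>
    have := hprob t ht
    hrun.integral_round hK ht
      (g := fun j x c y => if c ≤ |y| ∧ |y| ≤ M then (1 : ℝ) else 0)
      (fun j => Measurable.ite
        ((measurableSet_le (measurable_snd.comp measurable_fst) measurable_snd.abs).inter
          (measurableSet_le measurable_snd.abs measurable_const)) measurable_const measurable_const)
      (h := fun _ => 1) (fun j => integrable_const _)
      (fun j x c y h0 h1 => by split_ifs <;> simp [h1.le])
  have hone : ∀ t < T, Integrable (fun ω => 1 - (state T (obs loss arm ω) t).x b) P :=
    fun t ht => (integrable_const (1 : ℝ)).sub (hrun.integrable_x hK ht.le b)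
  have hround : ∀ t ∈ Finset.range T, roundRegret T ν P loss arm b t ≤
      ∫ ω, (skipped T (obs loss arm ω) t - skipped T (obs loss arm ω) t /
        (state T (obs loss arm ω) t).x (arm t ω) * comparator K T b (arm t ω)) ∂P
      + 2 * σ / T
      + M * ∫ ω, (if (state T (obs loss arm ω) t).C (arm t ω) ≤ |loss t ω (arm t ω)| ∧
          |loss t ω (arm t ω)| ≤ M then (1 : ℝ) else 0) ∂P
      + σ ^ α * M ^ (1 - α) * ∫ ω, (1 - (state T (obs loss arm ω) t).x b) ∂P := by
    intro t ht
    have ht' := Finset.mem_range.1 ht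
    have := hprob t ht'
    have hs := hskip t ht'
    have hc := hcount t ht'
    have ho := hone t ht'
    have hmain := integral_mono (((hrun.integral_loss_arm hK hα ht' (hν t ht')).2.1).sub
      (integrable_const (∫ l, l ∂ν t b)))
      (((hs.2.1.add (integrable_const (2 * σ / T))).add (hc.2.1.const_mul M)).add
        (ho.const_mul (σ ^ α * M ^ (1 - α))))
      (fun ω => round_regret_le hK hT hα hσ (hν t ht') (hb t ht')
        (isFTRL_x (T := T) (obs := obs loss arm ω) hK t).1 (fun j => C_pos hK t j) hM)
    rw [integral_sub' (hrun.integral_loss_arm hK hα ht' (hν t ht')).2.1 (integrable_const _),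
      integral_add' ((hs.2.1.add (integrable_const _)).add (hc.2.1.const_mul M)) (ho.const_mul _),
      integral_add' (hs.2.1.add (integrable_const _)) (hc.2.1.const_mul M),
      integral_add' hs.2.1 (integrable_const _), integral_const_mul, integral_const_mul,
      ← hs.2.2, ← hc.2.2, integral_const, integral_const, probReal_univ, one_smul,
      one_smul] at hmain
    exact hmain
  refine (Finset.sum_le_sum hround).trans ?_
  rw [Finset.sum_add_distrib, Finset.sum_add_distrib, Finset.sum_add_distrib, ← Finset.mul_sum,
    ← Finset.mul_sum]
  have h1 := (integral_finsetSum _ fun t ht => (hskip t (Finset.mem_range.1 ht)).1).symm.trans_le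
    (integral_mono
      (integrable_finsetSum (Finset.range T) fun t ht => (hskip t (Finset.mem_range.1 ht)).1)
      ((hrun.integrable_S hK hT).const_mul (14 * scale K T))
      (fun ω => sum_skipped_sub_comparator_le (obs := obs loss arm ω) hK hT hKT b T))
  have h2 := (integral_finsetSum _ fun t ht => (hcount t (Finset.mem_range.1 ht)).1).symm.trans_le
    (integral_mono
      (integrable_finsetSum (Finset.range T) fun t ht => (hcount t (Finset.mem_range.1 ht)).1)
      (integrable_const (1 + 34 * scale K T * max 0 (Real.log M)))
      (fun ω => card_skip_le (obs := obs loss arm ω) hK hT T))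
  rw [integral_const_mul] at h1
  rw [integral_const, probReal_univ, one_smul] at h2
  have h3 : ∑ _t ∈ Finset.range T, 2 * σ / T = 2 * σ := by
    rw [Finset.sum_const, Finset.card_range, nsmul_eq_mul]; field_simp
  rw [h3]
  have h4 := mul_le_mul_of_nonneg_left h2 hM.le
  exact add_le_add (add_le_add (add_le_add h1 le_rfl) h4) le_rfl

/-- The expected final inverse learning rate; the level `A` is free. -/
theorem IsRun.integral_S_le (hrun : IsRun T ν P loss arm) (hK : 2 ≤ K) (hT : 2 ≤ T)
    (hα : 1 < α) (hα2 : α ≤ 2) (hν : ∀ t < T, ∀ i, HeavyTailed α σ (ν t i))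
    (b : Fin K) {A : ℝ} (hA : 0 < A) (hσ : 0 ≤ σ) :
    ∫ ω, (state T (obs loss arm ω) T).S ∂P ≤ A +
      (4 ^ α + 2 * σ ^ α * exploration T P loss arm b / scale K T) * A ^ (1 - α) := by
  have hN := one_le_scale hK hT
  have hNinv : (scale K T)⁻¹ ≤ 1 := inv_le_one_of_one_le₀ hN
  have hN0 : 0 ≤ (scale K T)⁻¹ := by positivity
  have hloss := fun t (ht : t < T) =>
    hrun.integral_round hK ht
      (g := fun j x c y => |y| ^ α * (1 - x) * (scale K T)⁻¹)
      (fun j => ((measurable_snd.abs.pow_const α).mul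
        ((measurable_fst.comp measurable_fst).const_sub 1)).mul_const _)
      (fun j => (hν t ht j).1)
      (fun j x c y h0 h1 => by
        have h2 : 0 ≤ |y| ^ α := by positivity
        rw [abs_of_nonneg (mul_nonneg (mul_nonneg h2 (by linarith)) hN0)]
        have h3 : x * (1 - x) * (scale K T)⁻¹ ≤ 1 :=
          mul_le_one₀ (by nlinarith) hN0 hNinv
        calc x * (|y| ^ α * (1 - x) * (scale K T)⁻¹)
            = |y| ^ α * (x * (1 - x) * (scale K T)⁻¹) := by ring
          _ ≤ |y| ^ α * 1 := by gcongr
          _ = |y| ^ α := mul_one _)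
  have hround : ∀ t ∈ Finset.range T, ∫ ω, |loss t ω (arm t ω)| ^ α *
      (1 - (state T (obs loss arm ω) t).x (arm t ω)) * (scale K T)⁻¹ ∂P ≤
        2 * σ ^ α * (scale K T)⁻¹ * ∫ ω, (1 - (state T (obs loss arm ω) t).x b) ∂P := by
    intro t ht
    have ht' := Finset.mem_range.1 ht
    have hl := hloss t ht'
    rw [hl.2.2, ← integral_const_mul]
    refine integral_mono hl.2.1 (((integrable_const (1 : ℝ)).sub
      (hrun.integrable_x hK ht'.le b)).const_mul _) fun ω => ?_
    have hx := (isFTRL_x (T := T) (obs := obs loss arm ω) hK t).1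
    dsimp only
    set x := (state T (obs loss arm ω) t).x
    calc ∑ j, x j * ∫ y, |y| ^ α * (1 - x j) * (scale K T)⁻¹ ∂ν t j
        ≤ ∑ j, σ ^ α * (scale K T)⁻¹ * (x j * (1 - x j)) := by
          refine Finset.sum_le_sum fun j _ => ?_
          rw [integral_mul_const, integral_mul_const]
          have h1 := mul_le_mul_of_nonneg_right (hν t ht' j).2
            (mul_nonneg (mul_nonneg (hx.2 j).le (sub_nonneg.2 (posSimplex.le_one hx j))) hN0)
          linarith
      _ = σ ^ α * (scale K T)⁻¹ * ∑ j, x j * (1 - x j) := by rw [Finset.mul_sum]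
      _ ≤ σ ^ α * (scale K T)⁻¹ * (2 * (1 - x b)) := by
          gcongr
          rw [← Finset.add_sum_erase _ _ (Finset.mem_univ b)]
          have h1 : ∑ j ∈ Finset.univ.erase b, x j * (1 - x j) ≤
              ∑ j ∈ Finset.univ.erase b, x j := Finset.sum_le_sum fun j _ => by
            nlinarith [hx.2 j]
          rw [posSimplex.sum_erase hx] at h1
          nlinarith [hx.2 b, posSimplex.le_one hx b]
      _ = _ := by ring
  have hpt : ∀ S : ℝ, 0 < S → S ≤ A + S ^ α * A ^ (1 - α) := by
    intro S hS
    rcases le_total S A with h | h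
    · have : 0 ≤ S ^ α * A ^ (1 - α) := by positivity
      linarith
    · have h1 : S ^ (1 - α) ≤ A ^ (1 - α) := Real.rpow_le_rpow_of_nonpos hA h (by linarith)
      have h2 : S ^ α * S ^ (1 - α) = S := by rw [← Real.rpow_add hS]; simp
      have h3 : S ^ α * S ^ (1 - α) ≤ S ^ α * A ^ (1 - α) := by gcongr
      linarith
  have hint : Integrable (fun ω => ∑ t ∈ Finset.range T, |loss t ω (arm t ω)| ^ α *
      (1 - (state T (obs loss arm ω) t).x (arm t ω)) * (scale K T)⁻¹) P :=
    integrable_finsetSum (Finset.range T) fun t ht => (hloss t (Finset.mem_range.1 ht)).1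
  have h := integral_mono (hrun.integrable_S hK hT)
    ((integrable_const A).add (((integrable_const ((4 : ℝ) ^ α)).add hint).mul_const
      (A ^ (1 - α))))
    (fun ω => (hpt _ (S_pos T)).trans (add_le_add le_rfl (mul_le_mul_of_nonneg_right
      (S_rpow_le (obs := obs loss arm ω) hK hT hα hα2 T) (by positivity))))
  rw [integral_add' (integrable_const A) (((integrable_const _).add hint).mul_const _),
    integral_mul_const, integral_add' (integrable_const _) hint, integral_const, integral_const,
    probReal_univ, one_smul, one_smul,
    integral_finsetSum _ fun t ht => (hloss t (Finset.mem_range.1 ht)).1] at h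
  refine h.trans ?_
  gcongr
  refine (Finset.sum_le_sum hround).trans (le_of_eq ?_)
  rw [← Finset.mul_sum, exploration]
  ring

/-- In a stochastic environment the regret controls the exploration. -/
theorem IsRun.minGap_mul_exploration_le (hrun : IsRun T ν P loss arm) (hK : 2 ≤ K) (hα : 1 < α)
    (hν : ∀ t < T, ∀ i, HeavyTailed α σ (ν t i)) (hst : IsStochastic T ν) (b : Fin K) :
    minGap ν b * exploration T P loss arm b ≤
      ∑ t ∈ Finset.range T, roundRegret T ν P loss arm b t := by
  rw [exploration, Finset.mul_sum]
  refine Finset.sum_le_sum fun t ht => ?_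
  have ht' := Finset.mem_range.1 ht
  have hl := (hrun.integral_loss_arm hK hα ht' (hν t ht')).2.1
  have hgap : ∀ j, j ≠ b → minGap ν b ≤ ∫ l, l ∂ν t j - ∫ l, l ∂ν t b := fun j hj => by
    rw [hst t ht' j, hst t ht' b]
    exact ciInf_le (f := fun i : {i : Fin K // i ≠ b} => gap ν b i)
      (Set.finite_range _).bddBelow ⟨j, hj⟩
  have h := integral_mono (((integrable_const (1 : ℝ)).sub
      (hrun.integrable_x hK ht'.le b)).const_mul (minGap ν b))
    (hl.sub (integrable_const (∫ l, l ∂ν t b))) (fun ω => by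
      have hx := (isFTRL_x (T := T) (obs := obs loss arm ω) hK t).1
      simp only [Pi.sub_apply]
      set x := (state T (obs loss arm ω) t).x
      have e : ∑ j, x j * ∫ l, l ∂ν t j - ∫ l, l ∂ν t b =
          ∑ j ∈ Finset.univ.erase b, x j * (∫ l, l ∂ν t j - ∫ l, l ∂ν t b) := by
        have h1 : ∑ j, x j * (∫ l, l ∂ν t j - ∫ l, l ∂ν t b) =
            ∑ j, x j * ∫ l, l ∂ν t j - ∫ l, l ∂ν t b := by
          simp only [mul_sub, Finset.sum_sub_distrib, ← Finset.sum_mul, hx.1.2, one_mul]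
        rw [← h1, ← Finset.add_sum_erase _ _ (Finset.mem_univ b), sub_self, mul_zero, zero_add]
      rw [e, ← posSimplex.sum_erase hx, Finset.mul_sum]
      refine Finset.sum_le_sum fun j hj => ?_
      rw [mul_comm]
      exact mul_le_mul_of_nonneg_left (hgap j (Finset.ne_of_mem_erase hj)) (hx.2 j).le)
  rw [integral_const_mul, integral_sub' hl (integrable_const _), integral_const, probReal_univ,
    one_smul] at h
  exact h

end Expectation

/-! ### Choice of the free levels -/

section Tuning

variable {α σ N U R : ℝ}

/-- With `U ≤ T` as the only information on the exploration, the levels `A = 4 + B` and `M = B` for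
`B = σ (T / N) ^ (1 / α)` balance the bound. -/
theorem adversarial_level_bound (hα : 1 < α) (hσ : 0 < σ) (hN : 1 ≤ N) {T : ℝ}
    (hT : 1 ≤ T) (hUT : U ≤ T)
    (h : ∀ A M : ℝ, 0 < A → 0 < M → R ≤ 14 * N * (A + (4 ^ α + 2 * σ ^ α * U / N) * A ^ (1 - α))
      + 2 * σ + M * (1 + 34 * N * max 0 (Real.log M)) + σ ^ α * M ^ (1 - α) * U) :
    R ≤ 112 * (σ * (N ^ (1 - 1 / α) * T ^ (1 / α)) *
      (1 + max 0 (Real.log (σ * (T / N) ^ (1 / α)))) + N) := by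
  have hN0 : 0 < N := by linarith
  have hT0 : 0 < T := by linarith
  have hα0 : 0 < α := by linarith
  set E := N ^ (1 - 1 / α) * T ^ (1 / α) with hE
  set B := σ * (T / N) ^ (1 / α) with hB
  have hB0 : 0 < B := by positivity
  have hE1 : 1 ≤ E := one_le_mul_of_one_le_of_one_le
    (Real.one_le_rpow hN (by rw [sub_nonneg, div_le_one hα0]; exact hα.le))
    (Real.one_le_rpow hT (by positivity))
  have hNB : N * B = σ * E := by
    rw [hB, hE, Real.div_rpow hT0.le hN0.le, Real.rpow_sub hN0, Real.rpow_one]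
    ring
  have hBα : N * B ^ α = σ ^ α * T := by
    rw [hB, Real.mul_rpow hσ.le (by positivity), ← Real.rpow_mul (by positivity),
      one_div_mul_cancel hα0.ne', Real.rpow_one]
    field_simp
  have hBB : σ ^ α * B ^ (1 - α) * T = N * B := by
    have : B ^ α * B ^ (1 - α) = B := by rw [← Real.rpow_add hB0]; simp
    calc σ ^ α * B ^ (1 - α) * T = σ ^ α * T * B ^ (1 - α) := by ring
      _ = N * (B ^ α * B ^ (1 - α)) := by rw [← hBα]; ring
      _ = N * B := by rw [this]
  have hA0 : 0 < 4 + B := by linarith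
  have h1 : (4 + B) ^ (1 - α) ≤ B ^ (1 - α) :=
    Real.rpow_le_rpow_of_nonpos hB0 (by linarith) (by linarith)
  have h2 : (4 : ℝ) ^ α * (4 + B) ^ (1 - α) ≤ 4 := by
    have : (4 + B) ^ (1 - α) ≤ (4 : ℝ) ^ (1 - α) :=
      Real.rpow_le_rpow_of_nonpos (by norm_num) (by linarith) (by linarith)
    calc (4 : ℝ) ^ α * (4 + B) ^ (1 - α) ≤ 4 ^ α * 4 ^ (1 - α) := by gcongr
      _ = 4 := by rw [← Real.rpow_add (by norm_num)]; simp
  have hσα : 0 < σ ^ α := Real.rpow_pos_of_pos hσ _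
  have h3 : σ ^ α * (4 + B) ^ (1 - α) * U ≤ N * B := by
    calc σ ^ α * (4 + B) ^ (1 - α) * U ≤ σ ^ α * (4 + B) ^ (1 - α) * T := by gcongr
      _ ≤ σ ^ α * B ^ (1 - α) * T := by gcongr
      _ = N * B := hBB
  have h4 : σ ^ α * B ^ (1 - α) * U ≤ N * B := by
    rw [← hBB]; gcongr
  have h5 := h (4 + B) B hA0 hB0
  have h6 : 14 * N * (4 + B + (4 ^ α + 2 * σ ^ α * U / N) * (4 + B) ^ (1 - α)) =
      14 * N * (4 + B) + 14 * N * (4 ^ α * (4 + B) ^ (1 - α)) +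
        28 * (σ ^ α * (4 + B) ^ (1 - α) * U) := by
    field_simp; ring
  have h7 : 14 * N * (4 ^ α * (4 + B) ^ (1 - α)) ≤ 14 * N * 4 := by gcongr
  have h8 : σ ≤ N * B := by rw [hNB]; nlinarith
  have hl : 0 ≤ max 0 (Real.log B) := le_max_left _ _
  set l := max 0 (Real.log B)
  have h9 : B ≤ N * B := le_mul_of_one_le_left hB0.le hN
  rw [← hNB]
  have h10 : 0 ≤ N * B * l := by positivity
  rw [h6] at h5
  nlinarith

/-- When the exploration is bounded by the regret, levels of order `ρ ^ (1 / (α - 1))` make the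
terms with `U` at most half of the regret, which is then absorbed. -/
theorem stochastic_level_bound (hα : 1 < α) (hα2 : α ≤ 2) (hσ : 0 < σ) (hN : 1 ≤ N) {ρ : ℝ}
    (hσρ : σ ^ (α - 1) ≤ 2 * ρ) (hUρ : σ ^ α * U ≤ ρ * R)
    (h : ∀ A M : ℝ, 0 < A → 0 < M → R ≤ 14 * N * (A + (4 ^ α + 2 * σ ^ α * U / N) * A ^ (1 - α))
      + 2 * σ + M * (1 + 34 * N * max 0 (Real.log M)) + σ ^ α * M ^ (1 - α) * U) :
    R ≤ 394 * 112 ^ (1 / (α - 1)) *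
      (N * (1 + ρ ^ (1 / (α - 1)) * (1 + max 0 (Real.log ρ)))) := by
  have hN0 : 0 < N := by linarith
  have hα1 : 0 < α - 1 := by linarith
  have hρ : 0 < ρ := by
    have := Real.rpow_pos_of_pos hσ (α - 1)
    linarith
  set q := 1 / (α - 1) with hq
  have hq1 : 1 ≤ q := by rw [hq, one_le_div hα1]; linarith
  have hq0 : 0 < q := by linarith
  have hqα : (α - 1) * q = 1 := by rw [hq]; field_simp
  set Q := ρ ^ q with hQ
  have hQ0 : 0 < Q := Real.rpow_pos_of_pos hρ _
  have hlevel : ∀ c : ℝ, 0 < c → ((c * ρ) ^ q) ^ (1 - α) = (c * ρ)⁻¹ := fun c hc => by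
    rw [← Real.rpow_mul (by positivity), show q * (1 - α) = -1 by linarith, Real.rpow_neg_one]
  have hmul : ∀ c : ℝ, 0 < c → (c * ρ) ^ q = c ^ q * Q := fun c hc =>
    Real.mul_rpow hc.le hρ.le
  have hσq : σ ≤ 2 ^ q * Q := by
    rw [← hmul 2 (by norm_num)]
    calc σ = (σ ^ (α - 1)) ^ q := by rw [← Real.rpow_mul hσ.le, hqα, Real.rpow_one]
      _ ≤ (2 * ρ) ^ q := by gcongr
  -- `112 = 4 * 28` and `4` are such that the terms with `U` are at most a quarter of `R` each
  set A := 4 + (112 * ρ) ^ q with hA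
  set M := (4 * ρ) ^ q with hM
  have hA0 : 0 < A := by positivity
  have hM0 : 0 < M := by positivity
  have hR0 := h A M hA0 hM0
  have hA1 : A ^ (1 - α) ≤ (112 * ρ)⁻¹ := by
    rw [← hlevel 112 (by norm_num)]
    exact Real.rpow_le_rpow_of_nonpos (by positivity) (by linarith) (by linarith)
  have hA2 : (4 : ℝ) ^ α * A ^ (1 - α) ≤ 4 := by
    have h0 : 0 ≤ (112 * ρ) ^ q := by positivity
    have : A ^ (1 - α) ≤ (4 : ℝ) ^ (1 - α) :=
      Real.rpow_le_rpow_of_nonpos (by norm_num) (by linarith) (by linarith)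
    calc (4 : ℝ) ^ α * A ^ (1 - α) ≤ 4 ^ α * 4 ^ (1 - α) := by gcongr
      _ = 4 := by rw [← Real.rpow_add (by norm_num)]; simp
  have hself : ∀ c, 0 ≤ c → σ ^ α * c * U ≤ c * ρ * R := fun c hc => by
    have := mul_le_mul_of_nonneg_left hUρ hc
    linarith
  by_cases hRpos : R ≤ 0
  · have : 0 ≤ max 0 (Real.log ρ) := le_max_left _ _
    exact hRpos.trans (by positivity)
  push Not at hRpos
  have h3 : 28 * (σ ^ α * A ^ (1 - α) * U) ≤ R / 4 := by
    have h1 := hself (A ^ (1 - α)) (by positivity)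
    have h2 : A ^ (1 - α) * ρ ≤ 1 / 112 := by
      calc A ^ (1 - α) * ρ ≤ (112 * ρ)⁻¹ * ρ := by gcongr
        _ = 1 / 112 := by field_simp
    nlinarith
  have h4 : σ ^ α * M ^ (1 - α) * U ≤ R / 4 := by
    have h1 := hself (M ^ (1 - α)) (by positivity)
    have h2 : M ^ (1 - α) * ρ = 1 / 4 := by
      rw [hM, hlevel 4 (by norm_num)]; field_simp
    rw [h2] at h1; linarith
  have h6 : 14 * N * (A + (4 ^ α + 2 * σ ^ α * U / N) * A ^ (1 - α)) =
      14 * N * A + 14 * N * (4 ^ α * A ^ (1 - α)) + 28 * (σ ^ α * A ^ (1 - α) * U) := by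
    field_simp; ring
  have h7 : 14 * N * (4 ^ α * A ^ (1 - α)) ≤ 14 * N * 4 := by gcongr
  rw [h6] at hR0
  set l := max 0 (Real.log ρ) with hl
  have hl0 : 0 ≤ l := le_max_left _ _
  have hq2 : q ≤ 2 ^ q := by
    have h1 := one_add_mul_self_le_rpow_one_add (s := 1) (by norm_num) hq1
    norm_num at h1
    linarith
  have hlogM : max 0 (Real.log M) ≤ 2 * 2 ^ q * (1 + l) := by
    refine max_le (by positivity) ?_
    rw [hM, Real.log_rpow (by positivity), Real.log_mul (by norm_num) hρ.ne']
    have h1 : Real.log 4 ≤ 2 := by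
      rw [show (4 : ℝ) = 2 ^ 2 by norm_num, Real.log_pow]
      have := Real.log_two_lt_d9
      push_cast; linarith
    have h2 : Real.log ρ ≤ l := le_max_right _ _
    calc q * (Real.log 4 + Real.log ρ) ≤ q * (2 * (1 + l)) := by gcongr; linarith
      _ ≤ 2 ^ q * (2 * (1 + l)) := by gcongr
      _ = _ := by ring
  have h8 : M * (1 + 34 * N * max 0 (Real.log M)) ≤
      4 ^ q * Q + 68 * N * (8 ^ q * (Q * (1 + l))) := by
    have e : (8 : ℝ) ^ q = 4 ^ q * 2 ^ q := by
      rw [← Real.mul_rpow (by norm_num) (by norm_num)]; norm_num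
    rw [hM, hmul 4 (by norm_num), e] at *
    calc 4 ^ q * Q * (1 + 34 * N * max 0 (Real.log (4 ^ q * Q)))
        ≤ 4 ^ q * Q * (1 + 34 * N * (2 * 2 ^ q * (1 + l))) := by gcongr
      _ = _ := by ring
  set X := (112 : ℝ) ^ q with hX
  have hX1 : 1 ≤ X := Real.one_le_rpow (by norm_num) hq0.le
  have h2X : (2 : ℝ) ^ q ≤ X := Real.rpow_le_rpow (by norm_num) (by norm_num) hq0.le
  have h4X : (4 : ℝ) ^ q ≤ X := Real.rpow_le_rpow (by norm_num) (by norm_num) hq0.le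
  have h8X : (8 : ℝ) ^ q ≤ X := Real.rpow_le_rpow (by norm_num) (by norm_num) hq0.le
  have hAX : 14 * N * A = 56 * N + 14 * (N * (X * Q)) := by
    rw [hA, hmul 112 (by norm_num)]; ring
  set W := 1 + Q * (1 + l) with hW
  have hQW : Q ≤ W := by nlinarith
  have hQW' : Q * (1 + l) ≤ W := by linarith
  have hW1 : 1 ≤ W := by nlinarith
  have hXW : 1 ≤ X * W := one_le_mul_of_one_le_of_one_le hX1 hW1
  have b1 : N ≤ N * (X * W) := le_mul_of_one_le_right hN0.le hXW
  have b2 : N * (X * Q) ≤ N * (X * W) := by gcongr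
  have b0 : X * W ≤ N * (X * W) := le_mul_of_one_le_left (by linarith) hN
  have b3 : 2 ^ q * Q ≤ N * (X * W) :=
    (mul_le_mul h2X hQW hQ0.le (by linarith)).trans b0
  have b4 : 4 ^ q * Q ≤ N * (X * W) :=
    (mul_le_mul h4X hQW hQ0.le (by linarith)).trans b0
  have b5 : N * (8 ^ q * (Q * (1 + l))) ≤ N * (X * W) := by gcongr
  have e : 394 * X * (N * W) = 394 * (N * (X * W)) := by ring
  rw [e]
  linarith

end Tuning

/-! ### The regret bounds -/

section Bounds

variable {K T : ℕ} {α σ : ℝ} {Ω : Type*} [MeasurableSpace Ω] {P : Measure Ω}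
  [IsProbabilityMeasure P] {ν : ℕ → Fin K → Measure ℝ} {loss : ℕ → Ω → Fin K → ℝ}
  {arm : ℕ → Ω → Fin K}

/-- The regret in terms of the exploration, with free levels `A` of `S` and `M` of the losses. -/
theorem IsRun.sum_roundRegret_le_levels (hrun : IsRun T ν P loss arm) (hK : 2 ≤ K) (hT : 2 ≤ T)
    (hKT : K ≤ T) (hα : 1 < α) (hα2 : α ≤ 2) (hσ : 0 ≤ σ)
    (hν : ∀ t < T, ∀ i, HeavyTailed α σ (ν t i)) {b : Fin K}
    (hb : ∀ t < T, TruncatedNonneg (ν t b)) {A M : ℝ} (hA : 0 < A) (hM : 0 < M) :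
    ∑ t ∈ Finset.range T, roundRegret T ν P loss arm b t ≤
      14 * scale K T * (A + (4 ^ α + 2 * σ ^ α * exploration T P loss arm b / scale K T) *
        A ^ (1 - α)) + 2 * σ + M * (1 + 34 * scale K T * max 0 (Real.log M))
        + σ ^ α * M ^ (1 - α) * exploration T P loss arm b := by
  have h1 := hrun.sum_roundRegret_le hK hT hKT hα hσ hν hb hM
  have h2 := hrun.integral_S_le hK hT hα hα2 hν b hA hσ
  have h3 : 14 * scale K T * ∫ ω, (state T (obs loss arm ω) T).S ∂P ≤ 14 * scale K T * _ :=
    mul_le_mul_of_nonneg_left h2 (by linarith [one_le_scale hK hT])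
  linarith

theorem le_two_mul_scale (hT : 2 ≤ T) : (K : ℝ) ≤ 2 * scale K T := by
  have h2 : Real.log 2 ≤ Real.log T := Real.log_le_log (by norm_num) (by exact_mod_cast hT)
  have h3 := Real.log_two_gt_d9
  have h1 : (0 : ℝ) ≤ K := K.cast_nonneg
  unfold scale
  nlinarith

theorem IsRun.adversarial_bound (hrun : IsRun T ν P loss arm) (hK : 2 ≤ K) (hT : 2 ≤ T)
    (hα : 1 < α) (hα2 : α ≤ 2) (hσ : 0 ≤ σ)
    (hν : ∀ t < T, ∀ i, HeavyTailed α σ (ν t i)) {b : Fin K}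
    (hb : ∀ t < T, TruncatedNonneg (ν t b)) :
    ∑ t ∈ Finset.range T, roundRegret T ν P loss arm b t ≤
      112 * (σ * (scale K T ^ (1 - 1 / α) * (T : ℝ) ^ (1 / α)) *
        (1 + max 0 (Real.log (σ * ((T : ℝ) / scale K T) ^ (1 / α)))) + scale K T) := by
  have hN := one_le_scale hK hT
  have hT1 : (1 : ℝ) ≤ T := by exact_mod_cast (by omega : 1 ≤ T)
  have htriv := hrun.sum_roundRegret_le_trivial hK hα hσ hν b
  have hl : 0 ≤ max 0 (Real.log (σ * ((T : ℝ) / scale K T) ^ (1 / α))) := le_max_left _ _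
  rcases hσ.eq_or_lt with rfl | hσ0
  · rw [mul_zero, zero_mul] at htriv
    refine htriv.trans ?_
    rw [zero_mul, zero_mul, zero_add]
    linarith
  rcases le_or_gt K T with hKT | hKT
  · exact adversarial_level_bound hα hσ0 hN hT1 (exploration_le hK b) fun A M hA hM =>
      hrun.sum_roundRegret_le_levels hK hT hKT hα hα2 hσ hν hb hA hM
  · -- with more arms than rounds the trivial bound is good enough
    have h1 : (T : ℝ) / 2 ≤ scale K T := by
      have := le_two_mul_scale (K := K) hT
      have : (T : ℝ) ≤ K := by exact_mod_cast hKT.le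
      linarith
    have hα0 : 0 < α := by linarith
    have hexp : 0 ≤ 1 - 1 / α := by rw [sub_nonneg, div_le_one hα0]; exact hα.le
    have h2 : (T : ℝ) / 2 ≤ scale K T ^ (1 - 1 / α) * (T : ℝ) ^ (1 / α) := by
      calc (T : ℝ) / 2 = ((T : ℝ) / 2) ^ (1 - 1 / α) * ((T : ℝ) / 2) ^ (1 / α) := by
            rw [← Real.rpow_add (by positivity)]; simp
        _ ≤ _ := by gcongr; linarith
    have h3 := mul_le_mul_of_nonneg_left h2 hσ
    have h4 : 0 ≤ σ * (scale K T ^ (1 - 1 / α) * (T : ℝ) ^ (1 / α)) :=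
      mul_nonneg hσ (by positivity)
    have h5 := mul_nonneg h4 hl
    linarith

/-- The truncated non-negative optimal arm is the unique best arm of a stochastic environment. -/
theorem IsOptimalArm.eq_of_unique (hT : 2 ≤ T) (hst : IsStochastic T ν) {b' b : Fin K}
    (hb' : IsOptimalArm T ν b') (hb : IsUniqueBestArm ν b) : b' = b := by
  by_contra hne
  have h1 := hb b' hne
  have h2 := hb' b
  have hsum : ∀ j, ∑ t ∈ Finset.range T, ∫ l, l ∂ν t j = T * ∫ l, l ∂ν 0 j := fun j => by
    rw [Finset.sum_congr rfl fun t ht =>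
      congrArg (fun μ => ∫ l, l ∂μ) (hst t (Finset.mem_range.1 ht) j)]
    simp
  rw [hsum, hsum] at h2
  have hT0 : (0 : ℝ) < T := by exact_mod_cast (by omega : 0 < T)
  have := le_of_mul_le_mul_left h2 hT0
  unfold gap at h1
  linarith

theorem minGap_pos (hK : 2 ≤ K) {b : Fin K} (hb : IsUniqueBestArm ν b) : 0 < minGap ν b := by
  have : Nontrivial (Fin K) := Fin.nontrivial_iff_two_le.2 hK
  obtain ⟨j, hj⟩ := exists_ne b
  have : Nonempty {i : Fin K // i ≠ b} := ⟨⟨j, hj⟩⟩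
  obtain ⟨i, hi⟩ := exists_eq_ciInf_of_finite (f := fun i : {i : Fin K // i ≠ b} => gap ν b i)
  rw [minGap, ← hi]
  exact hb i i.2

theorem IsRun.minGap_le (hrun : IsRun T ν P loss arm) (hK : 2 ≤ K) (hT : 2 ≤ T)
    (hα : 1 < α) (hσ : 0 ≤ σ) (hν : ∀ t < T, ∀ i, HeavyTailed α σ (ν t i)) (b : Fin K) :
    minGap ν b ≤ 2 * σ := by
  have : Nontrivial (Fin K) := Fin.nontrivial_iff_two_le.2 hK
  obtain ⟨j, hj⟩ := exists_ne b
  have h0 : 0 < T := by omega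
  have := fun j => hrun.isProbabilityMeasure h0 j
  have h1 : ∀ j, |∫ l, l ∂ν 0 j| ≤ σ := fun j =>
    (hν 0 h0 j).abs_integral_le hα hσ fun _ => le_rfl
  have h2 : minGap ν b ≤ gap ν b j :=
    ciInf_le (f := fun i : {i : Fin K // i ≠ b} => gap ν b i)
      (Set.finite_range _).bddBelow ⟨j, hj⟩
  have h3 := (abs_le.1 (h1 j)).2
  have h4 := (abs_le.1 (h1 b)).1
  unfold gap at h2
  linarith

theorem IsRun.stochastic_bound (hrun : IsRun T ν P loss arm) (hK : 2 ≤ K) (hT : 2 ≤ T)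
    (hα : 1 < α) (hα2 : α ≤ 2) (hσ : 0 ≤ σ)
    (hν : ∀ t < T, ∀ i, HeavyTailed α σ (ν t i)) {b : Fin K}
    (hb : ∀ t < T, TruncatedNonneg (ν t b)) (hst : IsStochastic T ν)
    (hbest : IsUniqueBestArm ν b) {ρ : ℝ} (hρ : ρ = σ ^ α / minGap ν b) :
    ∑ t ∈ Finset.range T, roundRegret T ν P loss arm b t ≤ 394 * 112 ^ (1 / (α - 1)) *
      (scale K T * (1 + ρ ^ (1 / (α - 1)) * (1 + max 0 (Real.log ρ)))) := by
  have hN := one_le_scale hK hT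
  have hΔ := minGap_pos hK hbest
  have hΔσ := hrun.minGap_le hK hT hα hσ hν b
  have hσ0 : 0 < σ := by linarith
  have hσα : 0 < σ ^ α := Real.rpow_pos_of_pos hσ0 _
  have hρ0 : 0 < ρ := by rw [hρ]; positivity
  have hσρ : σ ^ (α - 1) ≤ 2 * ρ := by
    rw [hρ, Real.rpow_sub_one hσ0.ne', ← mul_div_assoc, div_le_div_iff₀ hσ0 hΔ]
    nlinarith
  rcases le_or_gt K T with hKT | hKT
  · refine stochastic_level_bound hα hα2 hσ0 hN hσρ ?_ fun A M hA hM =>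
      hrun.sum_roundRegret_le_levels hK hT hKT hα hα2 hσ hν hb hA hM
    have h1 := hrun.minGap_mul_exploration_le hK hα hν hst b
    have h2 : σ ^ α = ρ * minGap ν b := by rw [hρ]; field_simp
    rw [h2, mul_assoc]
    exact mul_le_mul_of_nonneg_left h1 hρ0.le
  · -- with more arms than rounds the trivial bound is good enough
    have htriv := hrun.sum_roundRegret_le_trivial hK hα hσ hν b
    have hα1 : 0 < α - 1 := by linarith
    have hTN : (T : ℝ) ≤ 2 * scale K T := by
      have := le_two_mul_scale (K := K) hT
      have : (T : ℝ) ≤ K := by exact_mod_cast hKT.le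
      linarith
    have hσq : σ ≤ 112 ^ (1 / (α - 1)) * ρ ^ (1 / (α - 1)) := by
      rw [← Real.mul_rpow (by norm_num) hρ0.le]
      calc σ = (σ ^ (α - 1)) ^ (1 / (α - 1)) := by
            rw [← Real.rpow_mul hσ, mul_one_div_cancel hα1.ne', Real.rpow_one]
        _ ≤ (112 * ρ) ^ (1 / (α - 1)) := by gcongr; linarith
    set X := (112 : ℝ) ^ (1 / (α - 1))
    have hX : 0 < X := by positivity
    set Q := ρ ^ (1 / (α - 1))
    have hQ : 0 < Q := by positivity
    have hl : 0 ≤ max 0 (Real.log ρ) := le_max_left _ _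
    have hQl := mul_nonneg hQ.le hl
    calc _ ≤ 2 * σ * T := htriv
      _ ≤ 2 * (X * Q) * (2 * scale K T) := by gcongr
      _ = 4 * X * (scale K T * Q) := by ring
      _ ≤ 394 * X * (scale K T * (1 + Q * (1 + max 0 (Real.log ρ)))) := by
          gcongr
          · norm_num
          · linarith

end Bounds

/-- A horizon beyond which the adversarial bound takes its asymptotic form. -/
noncomputable def largeHorizon (K : ℕ) (α σ : ℝ) : ℕ := ⌈max 3 (max σ (K * σ ^ (-α)))⌉₊

/-- For large horizons the logarithmic factor is of order `log T` and the term `K log T` is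
dominated. -/
theorem adversarial_large_horizon {K T : ℕ} {α σ : ℝ} (hK : 2 ≤ K) (hT : 2 ≤ T) (hα : 1 < α)
    (hσ : 0 < σ) (h : largeHorizon K α σ ≤ T) :
    σ * (scale K T ^ (1 - 1 / α) * (T : ℝ) ^ (1 / α)) *
        (1 + max 0 (Real.log (σ * ((T : ℝ) / scale K T) ^ (1 / α)))) + scale K T ≤
      4 * (σ * (scale K T ^ (1 - 1 / α) * (T : ℝ) ^ (1 / α)) * Real.log T) := by
  have hN := one_le_scale hK hT
  have hT0 : (0 : ℝ) < T := by exact_mod_cast (by omega : 0 < T)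
  have hK0 : (0 : ℝ) < K := by exact_mod_cast (by omega : 0 < K)
  have hα0 : 0 < α := by linarith
  have hle : max 3 (max σ (K * σ ^ (-α))) ≤ T := Nat.ceil_le.1 h
  have h3 : (3 : ℝ) ≤ T := (le_max_left _ _).trans hle
  have hσT : σ ≤ T := ((le_max_left _ _).trans (le_max_right _ _)).trans hle
  have hKσ : K * σ ^ (-α) ≤ T := ((le_max_right _ _).trans (le_max_right _ _)).trans hle
  have hlog : 1 ≤ Real.log T := by
    rw [Real.le_log_iff_exp_le hT0]
    linarith [Real.exp_one_lt_d9]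
  have hinv : 1 / α ≤ 1 := by rw [div_le_one hα0]; exact hα.le
  have hinv0 : 0 < 1 / α := by positivity
  have hN0 : 0 < scale K T := by linarith
  have hB : max 0 (Real.log (σ * ((T : ℝ) / scale K T) ^ (1 / α))) ≤ 2 * Real.log T := by
    refine max_le (by linarith) ?_
    rw [Real.log_mul hσ.ne' (by positivity), Real.log_rpow (by positivity),
      Real.log_div hT0.ne' hN0.ne']
    have h1 := Real.log_le_log hσ hσT
    have h2 := Real.log_nonneg hN
    nlinarith
  have hNle : scale K T ≤ σ * (scale K T ^ (1 - 1 / α) * (T : ℝ) ^ (1 / α)) * Real.log T := by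
    have h1 : (K : ℝ) ≤ σ ^ α * T := by
      rw [Real.rpow_neg hσ.le] at hKσ
      have := Real.rpow_pos_of_pos hσ α
      rw [← div_eq_mul_inv, div_le_iff₀ this] at hKσ
      linarith
    have h2 : scale K T ^ (1 / α) ≤ σ * (T : ℝ) ^ (1 / α) * Real.log T := by
      calc scale K T ^ (1 / α) = (K : ℝ) ^ (1 / α) * Real.log T ^ (1 / α) :=
            Real.mul_rpow hK0.le (by linarith)
        _ ≤ (σ ^ α * T) ^ (1 / α) * Real.log T ^ (1 : ℝ) :=
            mul_le_mul (Real.rpow_le_rpow hK0.le h1 hinv0.le)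
              (Real.rpow_le_rpow_of_exponent_le hlog hinv) (by positivity) (by positivity)
        _ = σ * (T : ℝ) ^ (1 / α) * Real.log T := by
            rw [Real.mul_rpow (by positivity) hT0.le, ← Real.rpow_mul hσ.le,
              mul_one_div_cancel hα0.ne', Real.rpow_one, Real.rpow_one]
    calc scale K T = scale K T ^ (1 - 1 / α) * scale K T ^ (1 / α) := by
          rw [← Real.rpow_add hN0]; simp
      _ ≤ scale K T ^ (1 - 1 / α) * (σ * (T : ℝ) ^ (1 / α) * Real.log T) := by gcongr
      _ = _ := by ring
  set D := σ * (scale K T ^ (1 - 1 / α) * (T : ℝ) ^ (1 / α))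
  have hD : 0 < D := by positivity
  have h5 := mul_le_mul_of_nonneg_left hB hD.le
  have h6 := mul_le_mul_of_nonneg_left hlog hD.le
  linarith

end UniINF

theorem theorem1 :
    ∃ (C : ℝ) (T₀ : ℕ → ℝ → ℝ → ℕ), 0 < C ∧
      ∀ (K T : ℕ) (α σ : ℝ), 2 ≤ K → 2 ≤ T → 1 < α → α ≤ 2 → 0 ≤ σ →
      ∀ ν : ℕ → Fin K → Measure ℝ,
      (∀ t < T, ∀ i, UniINF.HeavyTailed α σ (ν t i)) →
      (∃ b, UniINF.IsOptimalArm T ν b ∧ ∀ t < T, UniINF.TruncatedNonneg (ν t b)) →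
      ∀ (Ω : Type*) [MeasurableSpace Ω] (P : Measure Ω) [IsProbabilityMeasure P]
        (loss : ℕ → Ω → Fin K → ℝ) (arm : ℕ → Ω → Fin K),
      UniINF.IsRun T ν P loss arm →
      -- adversarial environments, for every horizon
      UniINF.regret T P loss arm ≤
          C * (σ * (K : ℝ) ^ (1 - 1 / α) * (T : ℝ) ^ (1 / α) * Real.log T ^ (1 - 1 / α)
                * (1 + max 0 (Real.log (σ * ((T : ℝ) / (K * Real.log T)) ^ (1 / α))))
              + K * Real.log T) ∧
      -- adversarial environments, for all large horizons
      (T₀ K α σ ≤ T →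
        UniINF.regret T P loss arm ≤
          C * (σ * (K : ℝ) ^ (1 - 1 / α) * (T : ℝ) ^ (1 / α) * Real.log T ^ (2 - 1 / α))) ∧
      -- stochastic environments
      (UniINF.IsStochastic T ν → ∀ b, UniINF.IsUniqueBestArm ν b →
        ∀ ρ : ℝ, ρ = σ ^ α / UniINF.minGap ν b →
          UniINF.regret T P loss arm ≤
            C ^ (1 / (α - 1)) * (K * Real.log T *
              (1 + ρ ^ (1 / (α - 1)) * (1 + max 0 (Real.log ρ)))) ∧
          (2 ≤ ρ →
            UniINF.regret T P loss arm ≤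
              C ^ (1 / (α - 1)) * (K * ρ ^ (1 / (α - 1)) * Real.log T * Real.log ρ))) := by
  -- `200000` exceeds `4 * 394 * 112`, which serves all three bounds
  refine ⟨200000, UniINF.largeHorizon, by norm_num, ?_⟩
  intro K T α σ hK hT hα hα2 hσ ν hν ⟨b, hopt, hb⟩ Ω _ P _ loss arm hrun
  have hN : 1 ≤ UniINF.scale K T := UniINF.one_le_scale hK hT
  have hN0 : 0 < UniINF.scale K T := by linarith
  have hK0 : (0 : ℝ) < K := by exact_mod_cast (by omega : 0 < K)
  have hT1 : (1 : ℝ) < T := by exact_mod_cast (by omega : 1 < T)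
  have hlog : 0 < Real.log T := Real.log_pos hT1
  have hreg := hrun.regret_le hK hα hν hopt
  have hadv := hreg.trans (hrun.adversarial_bound hK hT hα hα2 hσ hν hb)
  have hE : UniINF.scale K T ^ (1 - 1 / α) = (K : ℝ) ^ (1 - 1 / α) * Real.log T ^ (1 - 1 / α) :=
    Real.mul_rpow hK0.le hlog.le
  have hD0 : 0 ≤ σ * (UniINF.scale K T ^ (1 - 1 / α) * (T : ℝ) ^ (1 / α)) := by positivity
  refine ⟨?_, fun hT₀ => ?_, fun hst b' hbest ρ hρ => ?_⟩
  · have e : σ * (K : ℝ) ^ (1 - 1 / α) * (T : ℝ) ^ (1 / α) * Real.log T ^ (1 - 1 / α)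
        = σ * (UniINF.scale K T ^ (1 - 1 / α) * (T : ℝ) ^ (1 / α)) := by rw [hE]; ring
    rw [e]
    refine hadv.trans (mul_le_mul_of_nonneg_right (by norm_num) ?_)
    have hl : 0 ≤ max 0 (Real.log (σ * ((T : ℝ) / UniINF.scale K T) ^ (1 / α))) := le_max_left _ _
    positivity
  · rcases hσ.eq_or_lt with rfl | hσ0
    · have := hreg.trans (hrun.sum_roundRegret_le_trivial hK hα le_rfl hν b)
      simpa using this
    have h1 := UniINF.adversarial_large_horizon hK hT hα hσ0 hT₀
    have e : σ * (K : ℝ) ^ (1 - 1 / α) * (T : ℝ) ^ (1 / α) * Real.log T ^ (2 - 1 / α)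
        = σ * (UniINF.scale K T ^ (1 - 1 / α) * (T : ℝ) ^ (1 / α)) * Real.log T := by
      rw [hE, show (2 : ℝ) - 1 / α = (1 - 1 / α) + 1 by ring, Real.rpow_add_one hlog.ne']
      ring
    rw [e]
    have h2 := mul_nonneg hD0 hlog.le
    linarith
  · obtain rfl := hopt.eq_of_unique hT hst hbest
    have hst := hreg.trans (hrun.stochastic_bound hK hT hα hα2 hσ hν hb hst hbest hρ)
    have hα1 : 0 < α - 1 := by linarith
    have hq1 : 1 ≤ 1 / (α - 1) := by rw [one_le_div hα1]; linarith
    have hΔ := UniINF.minGap_pos hK hbest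
    have hρ0 : 0 ≤ ρ := by rw [hρ]; positivity
    have hC : 1576 * (112 : ℝ) ^ (1 / (α - 1)) ≤ 200000 ^ (1 / (α - 1)) := by
      have h1 : (1576 : ℝ) ≤ 1576 ^ (1 / (α - 1)) := by
        have := Real.rpow_le_rpow_of_exponent_le (show (1 : ℝ) ≤ 1576 by norm_num) hq1
        rwa [Real.rpow_one] at this
      calc 1576 * (112 : ℝ) ^ (1 / (α - 1))
          ≤ 1576 ^ (1 / (α - 1)) * 112 ^ (1 / (α - 1)) := by gcongr
        _ = (1576 * 112) ^ (1 / (α - 1)) := (Real.mul_rpow (by norm_num) (by norm_num)).symm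
        _ ≤ _ := by gcongr; norm_num
    have hX : (0 : ℝ) < 112 ^ (1 / (α - 1)) := by positivity
    have hl : 0 ≤ max 0 (Real.log ρ) := le_max_left _ _
    have hQ : 0 ≤ ρ ^ (1 / (α - 1)) := by positivity
    refine ⟨hst.trans (mul_le_mul_of_nonneg_right (by linarith) ?_), fun hρ2 => ?_⟩
    · exact mul_nonneg hN0.le (by positivity)
    · have h1 : Real.log 2 ≤ Real.log ρ := Real.log_le_log (by norm_num) hρ2
      have h2 := Real.log_two_gt_d9
      have h3 : 2 ≤ ρ ^ (1 / (α - 1)) := by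
        have := Real.rpow_le_rpow_of_exponent_le (show 1 ≤ ρ by linarith) hq1
        rw [Real.rpow_one] at this
        linarith
      rw [max_eq_right (by linarith)] at hst
      have h4 : 1 + ρ ^ (1 / (α - 1)) * (1 + Real.log ρ) ≤
          4 * (ρ ^ (1 / (α - 1)) * Real.log ρ) := by nlinarith
      calc _ ≤ _ := hst
        _ ≤ 394 * 112 ^ (1 / (α - 1)) *
            (UniINF.scale K T * (4 * (ρ ^ (1 / (α - 1)) * Real.log ρ))) := by gcongr
        _ = 1576 * 112 ^ (1 / (α - 1)) *
            (K * ρ ^ (1 / (α - 1)) * Real.log T * Real.log ρ) := by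
          unfold UniINF.scale; ring
        _ ≤ _ := mul_le_mul_of_nonneg_right hC
          (mul_nonneg (mul_nonneg (mul_nonneg hK0.le hQ) hlog.le) (by linarith))
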